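/- Let $r\in(0,1)$ and $A_r=\{z\in\mathbb C: r<|z|<1\}$, with boundary $bA_r$ and arc length measure $ds$ on $bA_r$. Let $H^2(bA_r)$ be the closure in $L^2(bA_r,ds)$ of the set of boundary traces of functions that are holomorphic on $A_r$ and $C^\infty$-smooth on $\overline{A_r}$; an element of $H^2(bA_r)$ is identified with its holomorphic extension to $A_r$. Then $A_r$ has a Szegő kernel, that is, a function $S(z,\zeta)$ such that $S(\cdot,\zeta)\in H^2(bA_r)$ for every $\zeta\in A_r$, $S(z,\zeta)=\overline{S(\zeta,z)}$ for all $z,\zeta\in A_r$, and $f(z)=\int_{bA_r}S(z,\zeta)f(\zeta)\,ds$ for all $f\in H^2(bA_r)$ and $z\in A_r$. For every such $S$ the function $S(z)=S(z,z)$ is positive on $A_r$, $\log S(z)$ is of class $C^2$ on $A_r$, and the Szegő metric $s(z)|dz|$, where $$s(z)=\sqrt{\frac{\partial^2\log S(z)}{\partial z\,\partial\overline z}},$$ satisfies $s(z)>0$ and $$s(z)^2\,|dz|^2=\frac{\wp\big(2\log|z|\big)-\wp\big(2\log|z|+\omega_1+\omega_3\big)}{|z|^2}\,|dz|^2\qquad(z\in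 A_r),$$ where $\omega_1=-\log r$, $\omega_3=i\pi$, and $\wp$ is the Weierstrass function with periods $2\omega_1=-2\log r$ and $2\omega_3=2\pi i$. -/

import Mathlib

open MeasureTheory Filter Topology
open scoped ContDiff ComplexConjugate

noncomputable section

namespace Szego

/-- The annulus `{z : r < |z| < 1}`. -/
def annulus (r : ℝ) : Set ℂ := {z | r < ‖z‖ ∧ ‖z‖ < 1}

/-- The arc length measure `|γ'(t)| dt` carried by a curve `γ : (a, b] → ℂ`
(in use: a simple closed curve with `γ a = γ b`, each point being run through once). -/
def arcLengthMeasure (γ : ℝ → ℂ) (a b : ℝ) : Measure ℂ :=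
  Measure.map γ ((volume.restrict (Set.Ioc a b)).withDensity
    fun t => ENNReal.ofReal ‖deriv γ t‖)

/-- The arc length measure on the boundary of the annulus `{r < |z| < 1}`, which consists of the
circles of radius `r` and `1` around the origin. -/
def annulusArcLength (r : ℝ) : Measure ℂ :=
  arcLengthMeasure (circleMap 0 r) 0 (2 * Real.pi) +
    arcLengthMeasure (circleMap 0 1) 0 (2 * Real.pi)

/-- The function `f` is holomorphic on `Ω` and `C^∞` up to the boundary. -/
def HolomorphicSmoothUpTo (Ω : Set ℂ) (f : ℂ → ℂ) : Prop :=
  DifferentiableOn ℂ f Ω ∧ ContDiffOn ℝ ∞ f (closure Ω)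

/-- The boundary traces, as elements of `L²(bΩ)`, of the functions which are holomorphic on `Ω`
and smooth up to the boundary. Here `σ` is the arc length measure on the boundary of `Ω`. -/
def boundaryTraces (Ω : Set ℂ) (σ : Measure ℂ) : Submodule ℂ (Lp ℂ 2 σ) where
  carrier := {F | ∃ f : ℂ → ℂ, HolomorphicSmoothUpTo Ω f ∧ F =ᵐ[σ] f}
  zero_mem' := ⟨0, ⟨differentiableOn_const 0, contDiffOn_const⟩, Lp.coeFn_zero ℂ 2 σ⟩
  add_mem' := by
    rintro F G ⟨f, ⟨hf, hf'⟩, hF⟩ ⟨g, ⟨hg, hg'⟩, hG⟩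
    exact ⟨f + g, ⟨hf.add hg, hf'.add hg'⟩, (Lp.coeFn_add F G).trans (hF.add hG)⟩
  smul_mem' := by
    rintro c F ⟨f, ⟨hf, hf'⟩, hF⟩
    exact ⟨c • f, ⟨hf.const_smul c, contDiffOn_const.smul hf'⟩,
      (Lp.coeFn_smul c F).trans (hF.const_smul c)⟩

/-- The Hardy space `H²(bΩ)`: the closure in `L²(bΩ)` of the space of boundary traces. -/
def hardySpace (Ω : Set ℂ) (σ : Measure ℂ) : Submodule ℂ (Lp ℂ 2 σ) :=
  (boundaryTraces Ω σ).topologicalClosure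

/-- The function `e` is, on `Ω`, the holomorphic extension of `F ∈ H²(bΩ)`: there are functions
`f n`, holomorphic on `Ω` and smooth up to the boundary, whose traces converge to `F` in `L²(bΩ)`
and which converge to `e` locally uniformly on `Ω`. (The Poisson integral reproduces each `f n`
from its trace and is continuous from `L²(bΩ)` to locally uniform convergence on `Ω`, so that
this `e` is the Poisson integral of `F`.) -/
def IsHolomorphicExtension (Ω : Set ℂ) (σ : Measure ℂ) (F : Lp ℂ 2 σ) (e : ℂ → ℂ) : Prop :=
  ∃ f : ℕ → ℂ → ℂ, (∀ n, HolomorphicSmoothUpTo Ω (f n)) ∧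
    Tendsto (fun n => eLpNorm (fun w => f n w - F w) 2 σ) atTop (𝓝 0) ∧
    TendstoLocallyUniformlyOn f e atTop Ω

/-- The function `S` is the Szegő kernel of `Ω`: the function `S(·, ζ)` is in `H²(bΩ)` for `ζ ∈ Ω`,
`S` is Hermitian, and it reproduces the elements of `H²(bΩ)`. The element `K ζ` of `H²(bΩ)` is the
boundary function of `S(·, ζ)`; thus, by Hermitian symmetry, `S(z, ζ)` for `z ∈ Ω` and `ζ ∈ bΩ`
is the conjugate of `(K z)(ζ)`. -/
def IsSzegoKernel (Ω : Set ℂ) (σ : Measure ℂ) (S : ℂ → ℂ → ℂ) : Prop :=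
  ∃ K : ℂ → Lp ℂ 2 σ,
    (∀ ζ ∈ Ω, K ζ ∈ hardySpace Ω σ ∧ IsHolomorphicExtension Ω σ (K ζ) (fun z => S z ζ)) ∧
    (∀ z ∈ Ω, ∀ ζ ∈ Ω, S z ζ = conj (S ζ z)) ∧
    (∀ F ∈ hardySpace Ω σ, ∀ e : ℂ → ℂ, IsHolomorphicExtension Ω σ F e →
      ∀ z ∈ Ω, e z = ∫ ζ, conj (K z ζ) * F ζ ∂σ)

/-- The Wirtinger derivative `∂/∂z = (∂/∂x - i ∂/∂y) / 2`. -/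
def wirtinger (f : ℂ → ℂ) (z : ℂ) : ℂ :=
  (fderiv ℝ f z 1 - Complex.I * fderiv ℝ f z Complex.I) / 2

/-- The Wirtinger derivative `∂/∂z̄ = (∂/∂x + i ∂/∂y) / 2`. -/
def wirtingerBar (f : ℂ → ℂ) (z : ℂ) : ℂ :=
  (fderiv ℝ f z 1 + Complex.I * fderiv ℝ f z Complex.I) / 2

/-- The density `s(z) = √(∂² log S(z, z) / ∂z ∂z̄)` of the Szegő metric `s(z) |dz|` attached to the
Szegő kernel `S`. -/
def szegoMetric (S : ℂ → ℂ → ℂ) (z : ℂ) : ℝ :=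
  Real.sqrt (wirtinger (wirtingerBar fun w => ((Real.log (S w w).re : ℝ) : ℂ)) z).re

/-- The periods `2ω₁ = -2 log r` and `2ω₃ = 2πi`. -/
def annulusPeriods (r : ℝ) (hr : r ∈ Set.Ioo (0 : ℝ) 1) : PeriodPair where
  ω₁ := ((-2 * Real.log r : ℝ) : ℂ)
  ω₂ := 2 * Real.pi * Complex.I
  indep := by
    have h := hr.1
    have h' := hr.2
    rw [LinearIndependent.pair_iff]
    intro s t hst
    have h1 := congrArg Complex.re hst
    have h2 := congrArg Complex.im hst
    simp at h1 h2
    refine ⟨?_, by simpa [Real.pi_ne_zero] using h2⟩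
    rcases h1 with h1 | h1 | h1 | h1 <;> linarith

end Szego

end

/-! The monomials zⁿ, n ∈ ℤ, are orthogonal in L² of the two boundary circles, with squared norm
2π(1 + r²ⁿ⁺¹), and their closed span contains H². Existence of the kernel follows by summing the
orthonormal expansion. Conversely, for any Szegő kernel, Parseval applied to its boundary function
forces S(z,z) = ∑ xⁿ / (2π(1 + r²ⁿ⁺¹)) with x = |z|² (`IsSzegoKernel.hasSum_diag`), so no separate
uniqueness statement is needed.

Put q = r² and θ(x) = (x;q)_∞ (q/x;q)_∞. The quotient θ(-rx)/θ(x) is multiplied by -r under x ↦ x/q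
and has a simple pole at x = 1. Comparing its Laurent coefficients on |x| = ρ and |x| = ρ/q by the
residue theorem shows that it is a constant times the series above (`hasSum_thetaQuotient`). Hence
log S(z,z) is, up to a constant, the real part of the logarithm of an infinite product.

For a radial function, ∂∂̄ g(|z|²) = |z|⁻² (x d/dx)² g. The operator (x d/dx)² sends log(1 -
cx^{±1}) to -k(cx^{±1}), where k(y) = y/(1-y)². This produces ∑ₙ [k(qⁿx) - k(-qⁿx/r)], whose terms
are all positive since k has the sign of its real argument. Finally ∑ₙ (v - 2πin)⁻² = k(eᵛ), so
summing the difference of two ℘ values along the rows of the lattice gives the same series: the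
arguments 2 log|z| and 2 log|z| - log r + iπ exponentiate to x and -x/r. -/

noncomputable section

namespace Szego

/-! ### Laurent coefficients as Fourier coefficients on circles -/

/-- The `n`-th Laurent coefficient of `f`, computed on the circle of radius `ρ`. -/
def laurentCoeff (f : ℂ → ℂ) (ρ : ℝ) (n : ℤ) : ℂ :=
  (2 * Real.pi : ℂ)⁻¹ *
    ∫ t in (0 : ℝ)..2 * Real.pi, f (circleMap 0 ρ t) * circleMap 0 ρ t ^ (-n)

theorem laurentCoeff_eq_circleIntegral (f : ℂ → ℂ) {ρ : ℝ} (hρ : ρ ≠ 0) (n : ℤ) :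
    laurentCoeff f ρ n =
      (2 * Real.pi * Complex.I)⁻¹ * ∮ z in C(0, ρ), (z - 0)⁻¹ • (f z * z ^ (-n)) := by
  have h : (∮ z in C(0, ρ), (z - 0)⁻¹ • (f z * z ^ (-n))) = Complex.I *
      ∫ t in (0 : ℝ)..2 * Real.pi, f (circleMap 0 ρ t) * circleMap 0 ρ t ^ (-n) := by
    rw [circleIntegral, ← intervalIntegral.integral_const_mul]
    apply intervalIntegral.integral_congr
    intro t _
    have h : circleMap 0 ρ t ≠ 0 := by simpa [circleMap] using hρ
    simp only [deriv_circleMap, smul_eq_mul, sub_zero]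
    field_simp
  rw [h, laurentCoeff, mul_inv _ Complex.I, mul_assoc, inv_mul_cancel_left₀ Complex.I_ne_zero]

/-- The Laurent coefficients of a function holomorphic on an annulus are the same on both
boundary circles. -/
theorem laurentCoeff_congr_radius {f : ℂ → ℂ} {a b : ℝ} (ha : 0 < a) (hab : a ≤ b)
    (hc : ContinuousOn f {z | a ≤ ‖z‖ ∧ ‖z‖ ≤ b})
    (hd : DifferentiableOn ℂ f {z | a < ‖z‖ ∧ ‖z‖ < b}) (n : ℤ) :
    laurentCoeff f b n = laurentCoeff f a n := by
  rw [laurentCoeff_eq_circleIntegral f ha.ne', laurentCoeff_eq_circleIntegral f (ha.trans_le hab).ne']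
  congr 1
  apply Complex.circleIntegral_sub_center_inv_smul_eq_of_differentiable_on_annulus_off_countable
    ha hab Set.countable_empty
  · have : Metric.closedBall (0 : ℂ) b \ Metric.ball 0 a = {z | a ≤ ‖z‖ ∧ ‖z‖ ≤ b} := by
      ext z; simp [and_comm]
    rw [this]
    refine hc.mul (ContinuousOn.zpow₀ continuousOn_id _ fun z hz => Or.inl ?_)
    exact norm_pos_iff.1 (ha.trans_le hz.1)
  · intro z hz
    have hz' : a < ‖z‖ ∧ ‖z‖ < b := by simpa [and_comm] using hz
    have ho : IsOpen {z : ℂ | a < ‖z‖ ∧ ‖z‖ < b} :=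
      (isOpen_lt continuous_const continuous_norm).inter (isOpen_lt continuous_norm continuous_const)
    exact ((hd z hz').differentiableAt (ho.mem_nhds hz')).mul
      (differentiableAt_zpow.2 (Or.inl (norm_pos_iff.1 (ha.trans hz'.1))))

/-- Cauchy's estimate. -/
theorem norm_laurentCoeff_le {f : ℂ → ℂ} {ρ C : ℝ} (hρ : 0 < ρ)
    (hC : ∀ z, ‖z‖ = ρ → ‖f z‖ ≤ C) (n : ℤ) : ‖laurentCoeff f ρ n‖ ≤ C * ρ ^ (-n) := by
  have h := intervalIntegral.norm_integral_le_of_norm_le_const (a := 0) (b := 2 * Real.pi)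
    (f := fun t => f (circleMap 0 ρ t) * circleMap 0 ρ t ^ (-n)) (C := C * ρ ^ (-n)) (by
      intro t _
      have h1 : ‖circleMap 0 ρ t‖ = ρ := by simp [abs_of_pos hρ]
      rw [norm_mul, norm_zpow, h1]
      gcongr
      exact hC _ h1)
  rw [laurentCoeff, norm_mul, norm_inv]
  have h2 : ‖(2 * Real.pi : ℂ)‖ = 2 * Real.pi := by
    simp [abs_of_pos Real.pi_pos]
  rw [h2, inv_mul_le_iff₀ Real.two_pi_pos, mul_comm (2 * Real.pi)]
  simpa [abs_of_pos Real.pi_pos] using h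

theorem fourierCoeffOn_circleMap (f : ℂ → ℂ) {ρ : ℝ} (hρ : 0 < ρ) (n : ℤ) :
    fourierCoeffOn Real.two_pi_pos (fun t => f (circleMap 0 ρ t)) n =
      laurentCoeff f ρ n * (ρ : ℂ) ^ n := by
  have hρ' : (ρ : ℂ) ≠ 0 := by exact_mod_cast hρ.ne'
  rw [fourierCoeffOn_eq_integral, laurentCoeff, sub_zero, one_div, mul_assoc,
    ← intervalIntegral.integral_mul_const, Complex.real_smul]
  push_cast
  congr 1
  apply intervalIntegral.integral_congr
  intro t _
  simp only [fourier_coe_apply, smul_eq_mul, circleMap, zero_add, mul_zpow, ← Complex.exp_int_mul]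
  rw [zpow_neg, mul_comm]
  field_simp
  congr 2
  have : (Real.pi : ℂ) ≠ 0 := by exact_mod_cast Real.pi_ne_zero
  push_cast
  field_simp

theorem continuous_comp_circleMap {f : ℂ → ℂ} {ρ : ℝ} (hρ : 0 ≤ ρ)
    (hc : ContinuousOn f {z | ‖z‖ = ρ}) : Continuous fun t => f (circleMap 0 ρ t) :=
  hc.comp_continuous (continuous_circleMap 0 ρ) fun t => by simp [abs_of_nonneg hρ]

/-- Parseval on one circle; the factor ρ²ⁿ converts Laurent into Fourier coefficients. -/
theorem hasSum_sq_laurentCoeff {f : ℂ → ℂ} {ρ : ℝ} (hρ : 0 < ρ)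
    (hc : ContinuousOn f {z | ‖z‖ = ρ}) :
    HasSum (fun n : ℤ => ‖laurentCoeff f ρ n‖ ^ 2 * ρ ^ (2 * n))
      ((2 * Real.pi)⁻¹ * ∫ t in (0 : ℝ)..2 * Real.pi, ‖f (circleMap 0 ρ t)‖ ^ 2) := by
  have hf := continuous_comp_circleMap hρ.le hc
  have h := hasSum_sq_fourierCoeffOn (f := fun t => f (circleMap 0 ρ t)) Real.two_pi_pos ?_
  · simp only [fourierCoeffOn_circleMap f hρ, sub_zero, smul_eq_mul] at h
    convert h using 2 with n
    rw [norm_mul, norm_zpow, Complex.norm_real, Real.norm_of_nonneg hρ.le, mul_pow, mul_comm 2 n,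
      zpow_mul]
    norm_cast
  · obtain ⟨C, hC⟩ := (isCompact_Icc (a := 0) (b := 2 * Real.pi)).exists_bound_of_continuousOn
      hf.continuousOn
    refine MemLp.of_bound hf.aestronglyMeasurable C ?_
    filter_upwards [ae_restrict_mem measurableSet_Ioc] with t ht
    exact hC t (Set.Ioc_subset_Icc_self ht)

/-- A continuous function with summable Fourier coefficients is the pointwise sum of its Fourier
series, read here at the angle `z.arg`. -/
theorem hasSum_laurentCoeff_of_summable {f : ℂ → ℂ} {z : ℂ} (hz : z ≠ 0)
    (hc : ContinuousOn f {w | ‖w‖ = ‖z‖})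
    (hs : Summable fun n : ℤ => laurentCoeff f ‖z‖ n * (‖z‖ : ℂ) ^ n) :
    HasSum (fun n : ℤ => laurentCoeff f ‖z‖ n * z ^ n) (f z) := by
  have hρ : 0 < ‖z‖ := norm_pos_iff.2 hz
  have hf := continuous_comp_circleMap hρ.le hc
  have : Fact (0 < 2 * Real.pi) := ⟨Real.two_pi_pos⟩
  have hper : Function.Periodic (fun t => f (circleMap 0 ‖z‖ t)) (2 * Real.pi) :=
    (periodic_circleMap 0 ‖z‖).comp f
  let F : C(AddCircle (2 * Real.pi), ℂ) := ⟨hper.lift, continuous_coinduced_dom.2 hf⟩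
  have hF : ∀ t : ℝ, F t = f (circleMap 0 ‖z‖ t) := fun t => rfl
  have hcoef : ∀ n, fourierCoeff F n = laurentCoeff f ‖z‖ n * (‖z‖ : ℂ) ^ n := by
    intro n
    rw [← fourierCoeffOn_circleMap f hρ, fourierCoeff_eq_intervalIntegral _ _ 0,
      fourierCoeffOn_eq_integral]
    simp [hF]
  have h := has_pointwise_sum_fourier_series_of_summable (f := F)
    (by simpa only [funext hcoef] using hs) (z.arg : ℝ)
  have hz' : circleMap 0 ‖z‖ z.arg = z := by simp [circleMap, Complex.norm_mul_exp_arg_mul_I]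
  rw [hF, hz'] at h
  convert h using 2 with n
  rw [hcoef, fourier_coe_apply, smul_eq_mul, mul_assoc]
  congr 1
  conv_lhs => rw [← hz', circleMap, zero_add, mul_zpow, ← Complex.exp_int_mul]
  congr 2
  have : (Real.pi : ℂ) ≠ 0 := by exact_mod_cast Real.pi_ne_zero
  push_cast
  field_simp

/-- Summability of a two-sided sequence dominated by geometric sequences on both sides. -/
theorem summable_int_of_norm_le_zpow {E : Type*} [NormedAddCommGroup E] [CompleteSpace E]
    {u : ℤ → E} {C a b x : ℝ} (ha : 0 < a) (hax : a < x) (hxb : x < b)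
    (h1 : ∀ n, ‖u n‖ ≤ C * b ^ (-n) * x ^ n) (h2 : ∀ n, ‖u n‖ ≤ C * a ^ (-n) * x ^ n) :
    Summable u := by
  have hx := ha.trans hax
  have hb := hx.trans hxb
  apply Summable.of_nat_of_neg
  · refine Summable.of_norm_bounded (g := fun n : ℕ => C * (x / b) ^ n)
      ((summable_geometric_of_lt_one (by positivity) ((div_lt_one hb).2 hxb)).mul_left C) fun n => ?_
    refine (h1 n).trans_eq ?_
    rw [div_pow, zpow_neg, zpow_natCast, zpow_natCast]
    ring
  · refine Summable.of_norm_bounded (g := fun n : ℕ => C * (a / x) ^ n)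
      ((summable_geometric_of_lt_one (by positivity) ((div_lt_one hx).2 hax)).mul_left C) fun n => ?_
    refine (h2 (-n)).trans_eq ?_
    rw [div_pow, neg_neg, zpow_neg, zpow_natCast, zpow_natCast]
    ring

/-- Laurent expansion of a function holomorphic on an annulus and continuous up to the boundary. -/
theorem hasSum_laurentCoeff {f : ℂ → ℂ} {a b : ℝ} (ha : 0 < a)
    (hc : ContinuousOn f {z | a ≤ ‖z‖ ∧ ‖z‖ ≤ b})
    (hd : DifferentiableOn ℂ f {z | a < ‖z‖ ∧ ‖z‖ < b}) {z : ℂ} (hz : a < ‖z‖ ∧ ‖z‖ < b) :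
    HasSum (fun n : ℤ => laurentCoeff f b n * z ^ n) (f z) := by
  have hz0 : 0 < ‖z‖ := ha.trans hz.1
  have hb := hz0.trans hz.2
  have hzb : ∀ n, laurentCoeff f b n = laurentCoeff f ‖z‖ n := laurentCoeff_congr_radius hz0 hz.2.le
    (hc.mono fun w hw => ⟨hz.1.le.trans hw.1, hw.2⟩)
    (hd.mono fun w hw => ⟨hz.1.trans hw.1, hw.2⟩)
  have hab : ∀ n, laurentCoeff f b n = laurentCoeff f a n :=
    laurentCoeff_congr_radius ha (hz.1.trans hz.2).le hc hd
  have hK : IsCompact {z : ℂ | a ≤ ‖z‖ ∧ ‖z‖ ≤ b} := by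
    refine (isCompact_closedBall (0 : ℂ) b).of_isClosed_subset
      ((isClosed_le continuous_const continuous_norm).inter
        (isClosed_le continuous_norm continuous_const)) fun w hw => ?_
    simpa using hw.2
  obtain ⟨C, hC⟩ := hK.exists_bound_of_continuousOn hc
  simp only [hzb]
  apply hasSum_laurentCoeff_of_summable (norm_pos_iff.1 hz0)
    (hc.mono fun w hw => ⟨hw.ge.trans' hz.1.le, hw.le.trans hz.2.le⟩)
  -- Cauchy's estimate on the outer circle gives geometric decay as n → ∞, on the inner circle as n
  -- → -∞.
  have key : ∀ ρ, 0 < ρ → (∀ w, ‖w‖ = ρ → ‖f w‖ ≤ C) →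
      (∀ n, laurentCoeff f ρ n = laurentCoeff f ‖z‖ n) →
      ∀ n : ℤ, ‖laurentCoeff f ‖z‖ n * (‖z‖ : ℂ) ^ n‖ ≤ C * ρ ^ (-n) * ‖z‖ ^ n := by
    intro ρ hρ hCρ h n
    rw [norm_mul, norm_zpow, Complex.norm_real, norm_norm, ← h n]
    gcongr
    exact norm_laurentCoeff_le hρ hCρ n
  have hle := (hz.1.trans hz.2).le
  exact summable_int_of_norm_le_zpow ha hz.1 hz.2
    (key b hb (fun w hw => hC w ⟨hle.trans hw.ge, hw.le⟩) hzb)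
    (key a ha (fun w hw => hC w ⟨hw.ge, hw.le.trans hle⟩) fun n => (hab n).symm.trans (hzb n))

theorem laurentCoeff_zpow {ρ : ℝ} (hρ : 0 < ρ) (m n : ℤ) :
    laurentCoeff (fun z => z ^ m) ρ n = if n = m then 1 else 0 := by
  have h0 : ∀ t, circleMap 0 ρ t ≠ 0 := fun t => by simpa [circleMap] using hρ.ne'
  have hpi : (2 * Real.pi * Complex.I : ℂ) ≠ 0 := Complex.two_pi_I_ne_zero
  rw [laurentCoeff_eq_circleIntegral _ hρ.ne']
  have : (∮ z in C(0, ρ), (z - 0)⁻¹ • (z ^ m * z ^ (-n))) =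
      ∮ z in C(0, ρ), (z - 0) ^ (m - n - 1) := by
    apply intervalIntegral.integral_congr
    intro t _
    simp only [sub_zero, smul_eq_mul]
    congr 1
    rw [← zpow_add₀ (h0 t), zpow_sub_one₀ (h0 t), sub_eq_add_neg m n, mul_comm]
  rw [this]
  split_ifs with h
  · subst h
    have := circleIntegral.integral_sub_center_inv (0 : ℂ) hρ.ne'
    simp only [sub_self, zero_sub, zpow_neg_one]
    rw [this, inv_mul_cancel₀ hpi]
  · rw [circleIntegral.integral_sub_zpow_of_ne (by omega), mul_zero]

/-! ### Arc length and L² on the boundary of the annulus -/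

/-- The closed annulus `{z : r ≤ |z| ≤ 1}`. -/
def closedAnnulus (r : ℝ) : Set ℂ := {z | r ≤ ‖z‖ ∧ ‖z‖ ≤ 1}

theorem isOpen_annulus (r : ℝ) : IsOpen (annulus r) :=
  (isOpen_lt continuous_const continuous_norm).inter (isOpen_lt continuous_norm continuous_const)

theorem isClosed_closedAnnulus (r : ℝ) : IsClosed (closedAnnulus r) :=
  (isClosed_le continuous_const continuous_norm).inter
    (isClosed_le continuous_norm continuous_const)

theorem isCompact_closedAnnulus (r : ℝ) : IsCompact (closedAnnulus r) :=
  (isCompact_closedBall (0 : ℂ) 1).of_isClosed_subset (isClosed_closedAnnulus r)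
    fun w hw => by simpa using hw.2

theorem closure_annulus_subset (r : ℝ) : closure (annulus r) ⊆ closedAnnulus r :=
  closure_minimal (fun _ hz => ⟨hz.1.le, hz.2.le⟩) (isClosed_closedAnnulus r)

/-- The direction z/|z| scaled by radii in (r, 1) stays in the annulus, and [r, 1] is the closure of
these radii. It makes functions smooth up to the boundary continuous on both circles. -/
theorem closedAnnulus_subset_closure {r : ℝ} (h0 : 0 < r) (h1 : r < 1) :
    closedAnnulus r ⊆ closure (annulus r) := by
  intro z hz
  have hz0 : 0 < ‖z‖ := h0.trans_le hz.1
  have hmem : ‖z‖ ∈ closure (Set.Ioo r 1) := by rw [closure_Ioo h1.ne]; exact hz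
  have hcont : Continuous fun t : ℝ => (t : ℂ) * (z / ‖z‖) := by fun_prop
  have := map_mem_closure hcont hmem (t := annulus r) (by
    intro t ht
    have h2 : ‖(t : ℂ) * (z / ‖z‖)‖ = t := by
      rw [norm_mul, norm_div, Complex.norm_real, Complex.norm_real, norm_norm, div_self hz0.ne',
        mul_one, Real.norm_of_nonneg (h0.trans ht.1).le]
    exact ⟨by rw [h2]; exact ht.1, by rw [h2]; exact ht.2⟩)
  rwa [mul_div_cancel₀] at this
  exact_mod_cast hz0.ne'

theorem arcLengthMeasure_circleMap {ρ : ℝ} (hρ : 0 ≤ ρ) :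
    arcLengthMeasure (circleMap 0 ρ) 0 (2 * Real.pi) =
      ENNReal.ofReal ρ • Measure.map (circleMap 0 ρ)
        (volume.restrict (Set.Ioc 0 (2 * Real.pi))) := by
  have h : (fun t => ENNReal.ofReal ‖deriv (circleMap 0 ρ) t‖) = fun _ => ENNReal.ofReal ρ := by
    funext t; simp [deriv_circleMap, abs_of_nonneg hρ]
  rw [arcLengthMeasure, h, withDensity_const, Measure.map_smul]

instance isFiniteMeasure_annulusArcLength (r : ℝ) [hr : Fact (r ∈ Set.Ioo (0 : ℝ) 1)] :
    IsFiniteMeasure (annulusArcLength r) := by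
  rw [annulusArcLength, arcLengthMeasure_circleMap hr.out.1.le,
    arcLengthMeasure_circleMap zero_le_one]
  have h : ∀ ρ : ℝ, IsFiniteMeasure (ENNReal.ofReal ρ • Measure.map (circleMap 0 ρ)
      (volume.restrict (Set.Ioc 0 (2 * Real.pi)))) := fun ρ =>
    (Measure.map (circleMap 0 ρ) (volume.restrict (Set.Ioc 0 (2 * Real.pi)))).smul_finite
      ENNReal.ofReal_ne_top
  have := h r
  have := h 1
  infer_instance

theorem ae_mem_circle {ρ : ℝ} (hρ : 0 ≤ ρ) :
    ∀ᵐ z ∂(arcLengthMeasure (circleMap 0 ρ) 0 (2 * Real.pi)), ‖z‖ = ρ := by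
  rw [arcLengthMeasure_circleMap hρ]
  refine Measure.ae_smul_measure ?_ _
  rw [ae_map_iff (continuous_circleMap 0 ρ).aemeasurable
    (isClosed_eq continuous_norm continuous_const).measurableSet]
  exact ae_of_all _ fun t => by simp [abs_of_nonneg hρ]

theorem aestronglyMeasurable_circle {ρ : ℝ} (hρ : 0 ≤ ρ) {f : ℂ → ℂ}
    (hc : ContinuousOn f {z | ‖z‖ = ρ}) :
    AEStronglyMeasurable f (arcLengthMeasure (circleMap 0 ρ) 0 (2 * Real.pi)) := by
  rw [← Measure.restrict_eq_self_of_ae_mem (ae_mem_circle hρ)]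
  exact hc.aestronglyMeasurable (isClosed_eq continuous_norm continuous_const).measurableSet

theorem integral_circle {ρ : ℝ} (hρ : 0 < ρ) {f : ℂ → ℂ} (hc : ContinuousOn f {z | ‖z‖ = ρ}) :
    ∫ z, f z ∂(arcLengthMeasure (circleMap 0 ρ) 0 (2 * Real.pi)) =
      ρ * ∫ t in (0 : ℝ)..2 * Real.pi, f (circleMap 0 ρ t) := by
  have h := aestronglyMeasurable_circle hρ.le hc
  rw [arcLengthMeasure_circleMap hρ.le] at h ⊢
  rw [integral_smul_measure, integral_map (continuous_circleMap 0 ρ).aemeasurable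
    (h.mono_ac (Measure.absolutelyContinuous_smul (ENNReal.ofReal_pos.2 hρ).ne')),
    intervalIntegral.integral_of_le Real.two_pi_pos.le, ENNReal.toReal_ofReal hρ.le,
    Complex.real_smul]

section

variable {r : ℝ} [hr : Fact (r ∈ Set.Ioo (0 : ℝ) 1)]

theorem ne_zero_of_mem_closedAnnulus {z : ℂ} (hz : z ∈ closedAnnulus r) : z ≠ 0 :=
  norm_pos_iff.1 (hr.out.1.trans_le hz.1)

theorem continuousOn_circles {f : ℂ → ℂ} (hc : ContinuousOn f (closedAnnulus r)) :
    ContinuousOn f {z | ‖z‖ = r} ∧ ContinuousOn f {z | ‖z‖ = 1} :=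
  ⟨hc.mono fun _ hz => ⟨hz.ge, hz.le.trans hr.out.2.le⟩,
    hc.mono fun _ hz => ⟨hr.out.2.le.trans hz.ge, hz.le⟩⟩

theorem ae_mem_closedAnnulus : ∀ᵐ z ∂(annulusArcLength r), z ∈ closedAnnulus r := by
  rw [annulusArcLength, ae_add_measure_iff]
  constructor
  · filter_upwards [ae_mem_circle hr.out.1.le] with z hz
    exact ⟨hz.ge, hz.le.trans hr.out.2.le⟩
  · filter_upwards [ae_mem_circle zero_le_one] with z hz
    exact ⟨hr.out.2.le.trans hz.ge, hz.le⟩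

theorem memLp_of_continuousOn {f : ℂ → ℂ} (hc : ContinuousOn f (closedAnnulus r)) (p : ENNReal) :
    MemLp f p (annulusArcLength r) := by
  obtain ⟨C, hC⟩ := (isCompact_closedAnnulus r).exists_bound_of_continuousOn hc
  refine MemLp.of_bound ?_ C ?_
  · rw [← Measure.restrict_eq_self_of_ae_mem ae_mem_closedAnnulus]
    exact hc.aestronglyMeasurable (isClosed_closedAnnulus r).measurableSet
  · filter_upwards [ae_mem_closedAnnulus] with z hz using hC z hz

theorem integral_annulusArcLength {f : ℂ → ℂ} (hc : ContinuousOn f (closedAnnulus r)) :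
    ∫ z, f z ∂(annulusArcLength r) = r * (∫ t in (0 : ℝ)..2 * Real.pi, f (circleMap 0 r t)) +
      ∫ t in (0 : ℝ)..2 * Real.pi, f (circleMap 0 1 t) := by
  have hi : Integrable f (annulusArcLength r) := memLp_one_iff_integrable.1
    (memLp_of_continuousOn hc 1)
  rw [annulusArcLength] at hi ⊢
  have h := continuousOn_circles hc
  rw [integral_add_measure hi.left_of_add_measure hi.right_of_add_measure,
    integral_circle hr.out.1 h.1, integral_circle one_pos h.2, Complex.ofReal_one, one_mul]

theorem HolomorphicSmoothUpTo.continuousOn {f : ℂ → ℂ}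
    (hf : HolomorphicSmoothUpTo (annulus r) f) : ContinuousOn f (closedAnnulus r) :=
  hf.2.continuousOn.mono (closedAnnulus_subset_closure hr.out.1 hr.out.2)

theorem holomorphicSmoothUpTo_zpow (n : ℤ) :
    HolomorphicSmoothUpTo (annulus r) (fun z => z ^ n) := by
  have h0 : ∀ z ∈ closure (annulus r), z ≠ 0 := fun z hz =>
    ne_zero_of_mem_closedAnnulus (closure_annulus_subset r hz)
  refine ⟨fun z hz => (differentiableAt_zpow.2
    (Or.inl (h0 z (subset_closure hz)))).differentiableWithinAt, fun z hz => ?_⟩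
  have : AnalyticAt ℂ (fun z : ℂ => z ^ n) z := analyticAt_id.zpow (h0 z hz)
  exact (this.contDiffAt.restrict_scalars ℝ).contDiffWithinAt

/-! ### Orthogonality of the monomials -/

variable (r) in
/-- The monomial `z ^ n` as an element of `L²` of the boundary of the annulus. -/
def monomialLp (n : ℤ) : Lp ℂ 2 (annulusArcLength r) :=
  (memLp_of_continuousOn (holomorphicSmoothUpTo_zpow (r := r) n).continuousOn 2).toLp _

variable (r) in
/-- The squared `L²` norm of `z ^ n` on the boundary of the annulus. -/
def monomialSqNorm (n : ℤ) : ℝ := 2 * Real.pi * (1 + r ^ (2 * n + 1))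

theorem monomialSqNorm_pos (n : ℤ) : 0 < monomialSqNorm r n := by
  have := hr.out.1
  have := Real.pi_pos
  unfold monomialSqNorm
  positivity

theorem inner_toLp {f g : ℂ → ℂ} (hf : ContinuousOn f (closedAnnulus r))
    (hg : ContinuousOn g (closedAnnulus r)) :
    inner ℂ ((memLp_of_continuousOn hf 2).toLp f) ((memLp_of_continuousOn hg 2).toLp g) =
      r * (∫ t in (0 : ℝ)..2 * Real.pi, conj (f (circleMap 0 r t)) * g (circleMap 0 r t)) +
      ∫ t in (0 : ℝ)..2 * Real.pi, conj (f (circleMap 0 1 t)) * g (circleMap 0 1 t) := by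
  rw [L2.inner_def]
  have h : ContinuousOn (fun z => conj (f z) * g z) (closedAnnulus r) :=
    (Complex.continuous_conj.comp_continuousOn hf).mul hg
  rw [← integral_annulusArcLength h]
  apply integral_congr_ae
  filter_upwards [(memLp_of_continuousOn hf 2).coeFn_toLp,
    (memLp_of_continuousOn hg 2).coeFn_toLp] with z h1 h2
  rw [h1, h2, RCLike.inner_apply, mul_comm]

/-- On |z| = ρ one has conj z = ρ²/z, which turns pairings with zⁿ into Laurent coefficients. -/
theorem conj_circleMap_zpow_mul {ρ : ℝ} (hρ : 0 < ρ) (n : ℤ) (t : ℝ) (w : ℂ) :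
    conj (circleMap 0 ρ t ^ n) * w = (ρ : ℂ) ^ (2 * n) * (w * circleMap 0 ρ t ^ (-n)) := by
  have h0 : circleMap 0 ρ t ≠ 0 := by simpa [circleMap] using hρ.ne'
  have h1 : conj (circleMap 0 ρ t) * circleMap 0 ρ t = (ρ : ℂ) ^ 2 := by
    rw [mul_comm, Complex.mul_conj, Complex.normSq_eq_norm_sq, norm_circleMap_zero, sq_abs]
    push_cast; rfl
  rw [zpow_mul, zpow_two, ← sq, ← h1, mul_zpow, zpow_neg, map_zpow₀]
  field_simp

/-- Both circles carry the same Laurent coefficient. The inner one contributes the weight r · r²ⁿ,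
with r from arc length, and the outer one the weight 1. -/
theorem inner_monomialLp {f : ℂ → ℂ} (hf : ContinuousOn f (closedAnnulus r))
    (hd : DifferentiableOn ℂ f (annulus r)) (n : ℤ) :
    inner ℂ (monomialLp r n) ((memLp_of_continuousOn hf 2).toLp f) =
      monomialSqNorm r n * laurentCoeff f 1 n := by
  have hpi : (Real.pi : ℂ) ≠ 0 := by exact_mod_cast Real.pi_ne_zero
  have h0 := hr.out.1
  have hr0 : (r : ℂ) ≠ 0 := by exact_mod_cast h0.ne'
  rw [monomialLp, inner_toLp (holomorphicSmoothUpTo_zpow n).continuousOn hf]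
  simp only [conj_circleMap_zpow_mul h0, conj_circleMap_zpow_mul one_pos,
    intervalIntegral.integral_const_mul]
  have h1 : ∀ ρ, (∫ t in (0 : ℝ)..2 * Real.pi, f (circleMap 0 ρ t) * circleMap 0 ρ t ^ (-n)) =
      2 * Real.pi * laurentCoeff f ρ n := fun ρ => by
    rw [laurentCoeff, mul_inv_cancel_left₀]
    simp
  rw [h1, h1, ← laurentCoeff_congr_radius h0 hr.out.2.le hf hd, monomialSqNorm]
  push_cast
  rw [one_zpow, zpow_add_one₀ hr0]
  ring

theorem inner_monomialLp_monomialLp (m n : ℤ) :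
    inner ℂ (monomialLp r n) (monomialLp r m) = if n = m then (monomialSqNorm r n : ℂ) else 0 := by
  have h := holomorphicSmoothUpTo_zpow (r := r) m
  rw [monomialLp.eq_1 r m, inner_monomialLp h.continuousOn h.1, laurentCoeff_zpow one_pos]
  simp

variable (r) in
/-- The normalized monomials on the boundary of the annulus. -/
def unitMonomialLp (n : ℤ) : Lp ℂ 2 (annulusArcLength r) :=
  ((√(monomialSqNorm r n))⁻¹ : ℂ) • monomialLp r n

theorem ofReal_sqrt_monomialSqNorm (n : ℤ) : ((√(monomialSqNorm r n) : ℝ) : ℂ) ≠ 0 := by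
  exact_mod_cast (Real.sqrt_pos.2 (monomialSqNorm_pos n)).ne'

theorem ofReal_sqrt_monomialSqNorm_sq (n : ℤ) :
    ((√(monomialSqNorm r n) : ℝ) : ℂ) ^ 2 = monomialSqNorm r n := by
  exact_mod_cast Real.sq_sqrt (monomialSqNorm_pos n).le

theorem inner_unitMonomialLp (n : ℤ) (F : Lp ℂ 2 (annulusArcLength r)) :
    inner ℂ (unitMonomialLp r n) F = (√(monomialSqNorm r n) : ℂ)⁻¹ * inner ℂ (monomialLp r n) F := by
  rw [unitMonomialLp, inner_smul_left, map_inv₀, Complex.conj_ofReal]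

theorem orthonormal_unitMonomialLp : Orthonormal ℂ (unitMonomialLp r) := by
  rw [orthonormal_iff_ite]
  intro n m
  rw [inner_unitMonomialLp, unitMonomialLp, inner_smul_right, inner_monomialLp_monomialLp]
  split_ifs with h
  · subst h
    have := ofReal_sqrt_monomialSqNorm (r := r) n
    rw [← ofReal_sqrt_monomialSqNorm_sq]
    field_simp
  · simp

/-- Parseval on each circle, added with the weights r and 1. The equality replaces any discussion of
convergence of the Laurent series on the boundary: it already forces the trace into the closed span
of the monomials. -/
theorem hasSum_norm_inner_unitMonomialLp {f : ℂ → ℂ} (hf : ContinuousOn f (closedAnnulus r))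
    (hd : DifferentiableOn ℂ f (annulus r)) :
    HasSum (fun n => ‖inner ℂ (unitMonomialLp r n) ((memLp_of_continuousOn hf 2).toLp f)‖ ^ 2)
      (‖(memLp_of_continuousOn hf 2).toLp f‖ ^ 2) := by
  have h0 := hr.out.1
  have h1 := hasSum_sq_laurentCoeff h0 (continuousOn_circles hf).1
  have h2 := hasSum_sq_laurentCoeff one_pos (continuousOn_circles hf).2
  have h3 := ((h1.mul_left r).add h2).mul_left (2 * Real.pi)
  have hpi := Real.pi_ne_zero
  convert! h3 using 1
  · funext n
    rw [inner_unitMonomialLp, inner_monomialLp hf hd,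
      ← laurentCoeff_congr_radius h0 hr.out.2.le hf hd, norm_mul, norm_mul, norm_inv,
      Complex.norm_real, Complex.norm_real, Real.norm_of_nonneg (Real.sqrt_nonneg _),
      Real.norm_of_nonneg (monomialSqNorm_pos n).le, mul_pow, mul_pow, inv_pow,
      Real.sq_sqrt (monomialSqNorm_pos n).le]
    have := (monomialSqNorm_pos (r := r) n).ne'
    field_simp
    rw [monomialSqNorm, zpow_add_one₀ h0.ne', one_zpow]
    ring
  · have h4 := inner_toLp hf hf
    rw [inner_self_eq_norm_sq_to_K] at h4
    simp only [Complex.conj_mul', Complex.coe_algebraMap] at h4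
    have h5 : ∀ ρ : ℝ, (∫ t in (0 : ℝ)..2 * Real.pi, (‖f (circleMap 0 ρ t)‖ : ℂ) ^ 2) =
        ((∫ t in (0 : ℝ)..2 * Real.pi, ‖f (circleMap 0 ρ t)‖ ^ 2 : ℝ) : ℂ) := fun ρ => by
      rw [← intervalIntegral.integral_ofReal]
      push_cast
      rfl
    rw [h5, h5] at h4
    have h6 : ‖(memLp_of_continuousOn hf 2).toLp f‖ ^ 2 =
        r * (∫ t in (0 : ℝ)..2 * Real.pi, ‖f (circleMap 0 r t)‖ ^ 2) +
          ∫ t in (0 : ℝ)..2 * Real.pi, ‖f (circleMap 0 1 t)‖ ^ 2 := by exact_mod_cast h4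
    rw [h6]
    field_simp

end

/-! ### Parseval's identity and closed spans -/

/-- A vector for which Parseval's identity holds is in the closed span of the orthonormal family. -/
theorem mem_closure_span_of_hasSum_norm_inner {ι E : Type*} [NormedAddCommGroup E]
    [InnerProductSpace ℂ E] {v : ι → E} (hv : Orthonormal ℂ v) {x : E}
    (hx : HasSum (fun i => ‖inner ℂ (v i) x‖ ^ 2) (‖x‖ ^ 2)) :
    x ∈ (Submodule.span ℂ (Set.range v)).topologicalClosure := by
  classical
  -- Bessel's identity: the squared distance to a partial sum is the missing part of Parseval's sum.
  have key : ∀ s : Finset ι, ‖x - ∑ i ∈ s, inner ℂ (v i) x • v i‖ ^ 2 =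
      ‖x‖ ^ 2 - ∑ i ∈ s, ‖inner ℂ (v i) x‖ ^ 2 := by
    intro s
    have h1 : inner ℂ x (∑ i ∈ s, inner ℂ (v i) x • v i) =
        ((∑ i ∈ s, ‖inner ℂ (v i) x‖ ^ 2 : ℝ) : ℂ) := by
      rw [inner_sum]
      push_cast
      refine Finset.sum_congr rfl fun i _ => ?_
      rw [inner_smul_right, ← inner_conj_symm x (v i), Complex.mul_conj']
    have h2 : ‖∑ i ∈ s, inner ℂ (v i) x • v i‖ ^ 2 = ∑ i ∈ s, ‖inner ℂ (v i) x‖ ^ 2 := by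
      have := hv.inner_sum (fun i => inner ℂ (v i) x) (fun i => inner ℂ (v i) x) s
      rw [inner_self_eq_norm_sq_to_K] at this
      simp only [Complex.conj_mul', Complex.coe_algebraMap] at this
      exact_mod_cast this
    rw [@norm_sub_sq ℂ, h1, h2]
    simp only [RCLike.re_to_complex, Complex.ofReal_re]
    ring
  have h : Tendsto (fun s : Finset ι => ‖x - ∑ i ∈ s, inner ℂ (v i) x • v i‖ ^ 2) atTop (𝓝 0) := by
    simp only [key]
    rw [← sub_self (‖x‖ ^ 2)]
    exact tendsto_const_nhds.sub hx
  have h' : Tendsto (fun s : Finset ι => ∑ i ∈ s, inner ℂ (v i) x • v i) atTop (𝓝 x) := by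
    rw [tendsto_iff_norm_sub_tendsto_zero]
    have := h.sqrt
    simp only [Real.sqrt_sq (norm_nonneg _), Real.sqrt_zero] at this
    simpa only [norm_sub_rev] using this
  exact mem_closure_of_tendsto h' (Eventually.of_forall fun s => Submodule.sum_mem _ fun i _ =>
    Submodule.smul_mem _ _ (Submodule.subset_span ⟨i, rfl⟩))

section

/-- Parseval's identity in the closed span of an orthonormal family. -/
theorem hasSum_inner_mul_inner_of_mem_closure_span {ι E : Type*} [NormedAddCommGroup E]
    [InnerProductSpace ℂ E] [CompleteSpace E] {v : ι → E} (hv : Orthonormal ℂ v) {x y : E}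
    (hx : x ∈ (Submodule.span ℂ (Set.range v)).topologicalClosure)
    (hy : y ∈ (Submodule.span ℂ (Set.range v)).topologicalClosure) :
    HasSum (fun i => inner ℂ x (v i) * inner ℂ (v i) y) (inner ℂ x y) := by
  set V := (Submodule.span ℂ (Set.range v)).topologicalClosure with hV
  have hmem : ∀ i, v i ∈ V := fun i =>
    Submodule.le_topologicalClosure _ (Submodule.subset_span ⟨i, rfl⟩)
  have : CompleteSpace V := (Submodule.isClosed_topologicalClosure _).completeSpace_coe
  let v' : ι → V := fun i => ⟨v i, hmem i⟩
  have hv' : Orthonormal ℂ v' := by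
    rw [← V.subtypeₗᵢ.orthonormal_comp_iff]
    exact hv
  -- A vector of `V` orthogonal to the span is orthogonal to its closure, hence to itself.
  have hbot : (Submodule.span ℂ (Set.range v'))ᗮ = ⊥ := by
    rw [Submodule.eq_bot_iff]
    intro w hw
    have h1 : ∀ u ∈ Submodule.span ℂ (Set.range v), inner ℂ u (w : E) = 0 := by
      intro u hu
      induction hu using Submodule.span_induction with
      | mem u hu =>
        obtain ⟨i, rfl⟩ := hu
        exact Submodule.inner_right_of_mem_orthogonal (u := v' i)
          (Submodule.subset_span (Set.mem_range_self i)) hw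
      | zero => exact inner_zero_left _
      | add a b _ _ ha hb => rw [inner_add_left, ha, hb, add_zero]
      | smul c a _ ha => rw [inner_smul_left, ha, mul_zero]
    have h2 : (w : E) ∈ closure {u : E | inner ℂ u (w : E) = 0} := closure_mono h1 w.2
    rw [(isClosed_eq (by fun_prop) continuous_const).closure_eq] at h2
    exact Subtype.ext (inner_self_eq_zero.1 h2)
  have h := (HilbertBasis.mkOfOrthogonalEqBot hv' hbot).hasSum_inner_mul_inner ⟨x, hx⟩ ⟨y, hy⟩
  simpa [HilbertBasis.coe_mkOfOrthogonalEqBot, v'] using h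

/-! ### The Hardy space and the Szegő kernel -/

theorem integral_conj_mul_eq_inner {σ : Measure ℂ} (F G : Lp ℂ 2 σ) :
    ∫ ζ, conj (F ζ) * G ζ ∂σ = inner ℂ F G := by
  rw [L2.inner_def]
  simp only [RCLike.inner_apply, mul_comm]

variable {r : ℝ} [hr : Fact (r ∈ Set.Ioo (0 : ℝ) 1)]

theorem exists_toLp_of_mem_boundaryTraces {F : Lp ℂ 2 (annulusArcLength r)}
    (hF : F ∈ boundaryTraces (annulus r) (annulusArcLength r)) :
    ∃ f : ℂ → ℂ, ∃ hf : HolomorphicSmoothUpTo (annulus r) f,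
      (memLp_of_continuousOn hf.continuousOn 2).toLp f = F := by
  obtain ⟨f, hf, hFf⟩ := hF
  refine ⟨f, hf, ?_⟩
  rw [← Lp.toLp_coeFn F (Lp.memLp F), MemLp.toLp_eq_toLp_iff]
  exact hFf.symm

theorem hardySpace_le_closure_span :
    hardySpace (annulus r) (annulusArcLength r) ≤
      (Submodule.span ℂ (Set.range (unitMonomialLp r))).topologicalClosure := by
  refine Submodule.topologicalClosure_minimal _ (fun F hF => ?_)
    (Submodule.isClosed_topologicalClosure _)
  obtain ⟨f, hf, rfl⟩ := exists_toLp_of_mem_boundaryTraces hF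
  exact mem_closure_span_of_hasSum_norm_inner orthonormal_unitMonomialLp
    (hasSum_norm_inner_unitMonomialLp hf.continuousOn hf.1)

theorem toLp_mem_boundaryTraces {f : ℂ → ℂ} (hf : HolomorphicSmoothUpTo (annulus r) f) :
    (memLp_of_continuousOn hf.continuousOn 2).toLp f ∈
      boundaryTraces (annulus r) (annulusArcLength r) :=
  ⟨f, hf, (memLp_of_continuousOn hf.continuousOn 2).coeFn_toLp⟩

theorem monomialLp_mem_boundaryTraces (n : ℤ) :
    monomialLp r n ∈ boundaryTraces (annulus r) (annulusArcLength r) :=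
  toLp_mem_boundaryTraces (holomorphicSmoothUpTo_zpow n)

theorem isHolomorphicExtension_monomialLp (n : ℤ) :
    IsHolomorphicExtension (annulus r) (annulusArcLength r) (monomialLp r n) (fun z => z ^ n) := by
  refine ⟨fun _ z => z ^ n, fun _ => holomorphicSmoothUpTo_zpow n, ?_, ?_⟩
  · have h := (memLp_of_continuousOn
      (holomorphicSmoothUpTo_zpow (r := r) n).continuousOn 2).coeFn_toLp
    have : eLpNorm (fun w => w ^ n - monomialLp r n w) 2 (annulusArcLength r) = 0 := by
      rw [eLpNorm_congr_ae (g := fun _ => (0 : ℂ))]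
      · simp
      · filter_upwards [h] with w hw
        rw [monomialLp, hw, sub_self]
    simp only [this, tendsto_const_nhds]
  · exact fun u hu z _ => ⟨annulus r, self_mem_nhdsWithin,
      Eventually.of_forall fun _ _ _ => refl_mem_uniformity hu⟩

/-- On the diagonal a Szegő kernel of the annulus is given by the Laurent series of the kernel. -/
theorem IsSzegoKernel.hasSum_diag {S : ℂ → ℂ → ℂ}
    (hS : IsSzegoKernel (annulus r) (annulusArcLength r) S) {z : ℂ} (hz : z ∈ annulus r) :
    HasSum (fun n : ℤ => (‖z‖ ^ 2) ^ n / monomialSqNorm r n) (S z z).re := by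
  obtain ⟨K, hK, -, hrep⟩ := hS
  -- Reproducing the monomials determines all coefficients of `K z`; reproducing `K z` itself
  -- identifies S(z,z) with its squared norm.
  have h1 : ∀ n, inner ℂ (K z) (monomialLp r n) = z ^ n := fun n => by
    rw [← integral_conj_mul_eq_inner]
    exact (hrep _ (Submodule.le_topologicalClosure _ (monomialLp_mem_boundaryTraces n)) _
      (isHolomorphicExtension_monomialLp n) z hz).symm
  have h2 : S z z = inner ℂ (K z) (K z) := by
    rw [← integral_conj_mul_eq_inner]
    exact hrep _ (hK z hz).1 _ (hK z hz).2 z hz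
  have hmem := hardySpace_le_closure_span (hK z hz).1
  have h3 := hasSum_inner_mul_inner_of_mem_closure_span orthonormal_unitMonomialLp hmem hmem
  rw [← h2] at h3
  convert! Complex.hasSum_re h3 using 1
  funext n
  have h4 : inner ℂ (unitMonomialLp r n) (K z) = conj (inner ℂ (K z) (unitMonomialLp r n)) :=
    (inner_conj_symm _ _).symm
  rw [h4, Complex.mul_conj', unitMonomialLp, inner_smul_right, h1, norm_mul, norm_inv, norm_zpow,
    Complex.norm_real, Real.norm_of_nonneg (Real.sqrt_nonneg _)]
  norm_cast
  rw [mul_pow, inv_pow, Real.sq_sqrt (monomialSqNorm_pos n).le, ← zpow_natCast, ← zpow_natCast,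
    ← zpow_mul, ← zpow_mul, mul_comm n, div_eq_inv_mul]

theorem norm_monomialLp (n : ℤ) : ‖monomialLp r n‖ = √(monomialSqNorm r n) := by
  have h := inner_self_eq_norm_sq (𝕜 := ℂ) (monomialLp r n)
  rw [inner_monomialLp_monomialLp, if_pos rfl, RCLike.re_to_complex, Complex.ofReal_re] at h
  rw [h, Real.sqrt_sq (norm_nonneg _)]

theorem one_le_sqrt_monomialSqNorm (n : ℤ) : 1 ≤ √(monomialSqNorm r n) := by
  rw [Real.one_le_sqrt, monomialSqNorm]
  have h := zpow_pos hr.out.1 (2 * n + 1)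
  nlinarith [Real.pi_gt_three]

/-- The sharper bound rⁿ⁺¹ᐟ² is weakened to rⁿ⁺¹ to keep integer exponents. -/
theorem zpow_le_sqrt_monomialSqNorm (n : ℤ) : r ^ n * r ≤ √(monomialSqNorm r n) := by
  have h0 := hr.out.1
  have h1 := hr.out.2
  apply Real.le_sqrt_of_sq_le
  rw [monomialSqNorm, zpow_add_one₀ h0.ne', mul_comm 2 n, zpow_mul, zpow_two, mul_pow, ← sq]
  have h2 := pow_pos (zpow_pos h0 n) 2
  have h3 : (r ^ n) ^ 2 * r ^ 2 ≤ (r ^ n) ^ 2 * r := by gcongr; nlinarith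
  nlinarith [Real.pi_gt_three, mul_pos h2 h0]

/-- The bound √w ≥ 1 handles n → ∞ because |ζ| < 1, and √w ≥ rⁿ⁺¹ handles n → -∞ because |ζ| > r.
The constant r⁻¹ absorbs the extra factor r. -/
theorem summable_zpow_div_sqrt_monomialSqNorm {ζ : ℂ} (hζ : ζ ∈ annulus r) :
    Summable fun n : ℤ => ‖ζ‖ ^ n / √(monomialSqNorm r n) := by
  have h0 := hr.out.1
  have h1 := hr.out.2
  have hζ0 : 0 < ‖ζ‖ := h0.trans hζ.1
  have hw : ∀ n : ℤ, 0 < √(monomialSqNorm r n) := fun n => Real.sqrt_pos.2 (monomialSqNorm_pos n)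
  refine summable_int_of_norm_le_zpow (C := r⁻¹) h0 hζ.1 hζ.2 (fun n => ?_) fun n => ?_
  · rw [Real.norm_of_nonneg (by have := hw n; positivity), one_zpow, mul_one, div_eq_inv_mul]
    gcongr
    exact h1.le.trans (one_le_sqrt_monomialSqNorm n)
  · rw [Real.norm_of_nonneg (by have := hw n; positivity), div_eq_inv_mul, zpow_neg, ← mul_inv,
      mul_comm r]
    gcongr
    exact zpow_le_sqrt_monomialSqNorm n

variable (r) in
/-- The boundary function of the Szegő kernel of the annulus with pole at `ζ`. -/
def kernelLp (ζ : ℂ) : Lp ℂ 2 (annulusArcLength r) :=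
  ∑' n : ℤ, ((conj ζ) ^ n / monomialSqNorm r n : ℂ) • monomialLp r n

variable (r) in
/-- The Szegő kernel of the annulus. -/
def annulusKernel (z ζ : ℂ) : ℂ := ∑' n : ℤ, ((conj ζ) ^ n / monomialSqNorm r n : ℂ) * z ^ n

theorem norm_kernel_coeff (ζ : ℂ) (n : ℤ) :
    ‖((conj ζ) ^ n / monomialSqNorm r n : ℂ)‖ = ‖ζ‖ ^ n / monomialSqNorm r n := by
  rw [norm_div, norm_zpow, Complex.norm_conj, Complex.norm_real,
    Real.norm_of_nonneg (monomialSqNorm_pos n).le]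

theorem hasSum_kernelLp {ζ : ℂ} (hζ : ζ ∈ annulus r) :
    HasSum (fun n : ℤ => ((conj ζ) ^ n / monomialSqNorm r n : ℂ) • monomialLp r n)
      (kernelLp r ζ) := by
  refine (Summable.of_norm ?_).hasSum
  convert! summable_zpow_div_sqrt_monomialSqNorm hζ using 2 with n
  rw [norm_smul, norm_kernel_coeff, norm_monomialLp]
  have h := monomialSqNorm_pos (r := r) n
  rw [div_mul_eq_mul_div, mul_div_assoc, Real.sqrt_div_self', ← div_eq_mul_one_div]

theorem kernelLp_mem_hardySpace {ζ : ℂ} (hζ : ζ ∈ annulus r) :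
    kernelLp r ζ ∈ hardySpace (annulus r) (annulusArcLength r) :=
  mem_closure_of_tendsto (hasSum_kernelLp hζ) (Eventually.of_forall fun _ =>
    Submodule.sum_mem _ fun n _ => Submodule.smul_mem _ _ (monomialLp_mem_boundaryTraces n))

theorem coeFn_sum_monomialLp (c : ℤ → ℂ) (s : Finset ℤ) :
    (∑ n ∈ s, c n • monomialLp r n : Lp ℂ 2 (annulusArcLength r)) =ᵐ[annulusArcLength r]
      fun z => ∑ n ∈ s, c n * z ^ n := by
  classical
  induction s using Finset.induction_on with
  | empty =>
    simp only [Finset.sum_empty]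
    exact Lp.coeFn_zero ℂ 2 (annulusArcLength r)
  | insert n s hn ih =>
    rw [Finset.sum_insert hn]
    have h := (memLp_of_continuousOn
      (holomorphicSmoothUpTo_zpow (r := r) n).continuousOn 2).coeFn_toLp
    filter_upwards [ih, Lp.coeFn_add (c n • monomialLp r n) (∑ n ∈ s, c n • monomialLp r n),
      Lp.coeFn_smul (c n) (monomialLp r n), h] with z h1 h2 h3 h4
    rw [h2, Pi.add_apply, h1, h3, Pi.smul_apply, Finset.sum_insert hn, monomialLp, h4, smul_eq_mul]

theorem holomorphicSmoothUpTo_sum (c : ℤ → ℂ) (s : Finset ℤ) :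
    HolomorphicSmoothUpTo (annulus r) (fun z => ∑ n ∈ s, c n * z ^ n) :=
  ⟨DifferentiableOn.fun_sum fun n _ => (holomorphicSmoothUpTo_zpow n).1.const_mul (c n),
    ContDiffOn.sum fun n _ => contDiffOn_const.mul (holomorphicSmoothUpTo_zpow n).2⟩

theorem isHolomorphicExtension_kernelLp {ζ : ℂ} (hζ : ζ ∈ annulus r) :
    IsHolomorphicExtension (annulus r) (annulusArcLength r) (kernelLp r ζ)
      (fun z => annulusKernel r z ζ) := by
  -- An extension asks for a sequence of approximants, so the sums over ℤ are cut off symmetrically.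
  have hs : Tendsto (fun N : ℕ => Finset.Icc (-N : ℤ) N) atTop atTop := by
    refine tendsto_atTop_finset_of_monotone (fun a b hab => ?_) fun x => ⟨x.natAbs, ?_⟩
    · exact Finset.Icc_subset_Icc (by simpa using hab) (by simpa using hab)
    · rw [Finset.mem_Icc]; omega
  refine ⟨fun N z => ∑ n ∈ Finset.Icc (-N : ℤ) N, ((conj ζ) ^ n / monomialSqNorm r n : ℂ) * z ^ n,
    fun N => holomorphicSmoothUpTo_sum _ _, ?_, ?_⟩
  · have h := (Lp.tendsto_Lp_iff_tendsto_eLpNorm' _ _).1 ((hasSum_kernelLp hζ).comp hs)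
    refine h.congr fun N => eLpNorm_congr_ae ?_
    filter_upwards [coeFn_sum_monomialLp (r := r)
      (fun n => ((conj ζ) ^ n / monomialSqNorm r n : ℂ)) (Finset.Icc (-N : ℤ) N)] with z hz
    rw [Pi.sub_apply, Function.comp_apply, hz]
  · have hb : Summable fun n : ℤ => (1 + r⁻¹) * (‖ζ‖ ^ n / √(monomialSqNorm r n)) :=
      (summable_zpow_div_sqrt_monomialSqNorm hζ).mul_left _
    have h := tendstoUniformlyOn_tsum (s := annulus r) hb
      (f := fun n z => ((conj ζ) ^ n / monomialSqNorm r n : ℂ) * z ^ n) (fun n z hz => ?_)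
    · exact TendstoUniformlyOn.tendstoLocallyUniformlyOn fun u hu => hs.eventually (h u hu)
    · have h0 := hr.out.1
      have hz0 := h0.trans hz.1
      have hζ0 : 0 < ‖ζ‖ := h0.trans hζ.1
      have hw : 0 < √(monomialSqNorm r n) := Real.sqrt_pos.2 (monomialSqNorm_pos n)
      -- For n ≥ 0, |z|ⁿ ≤ 1 ≤ √w; for n ≤ 0, |z|ⁿ ≤ rⁿ ≤ r⁻¹√w. The sum of both bounds is
      -- independent of z, so convergence is uniform on the whole annulus.
      have h1 : ‖z‖ ^ n ≤ (1 + r⁻¹) * √(monomialSqNorm r n) := by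
        have h2 := one_le_sqrt_monomialSqNorm (r := r) n
        have h3 : r ^ n ≤ r⁻¹ * √(monomialSqNorm r n) := by
          rw [← div_eq_inv_mul, le_div_iff₀ h0]
          exact zpow_le_sqrt_monomialSqNorm n
        have h4 : 0 < r⁻¹ * √(monomialSqNorm r n) := by positivity
        rcases le_total 0 n with hn | hn
        · have : ‖z‖ ^ n ≤ 1 := zpow_le_one₀ hz0 hz.2.le hn
          linarith
        · have : ‖z‖ ^ n ≤ r ^ n := by
            obtain ⟨m, rfl⟩ := Int.exists_eq_neg_ofNat hn
            rw [zpow_neg, zpow_neg, zpow_natCast, zpow_natCast]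
            gcongr
            exact hz.1.le
          linarith
      rw [norm_mul, norm_kernel_coeff, norm_zpow]
      calc ‖ζ‖ ^ n / monomialSqNorm r n * ‖z‖ ^ n
          ≤ ‖ζ‖ ^ n / monomialSqNorm r n * ((1 + r⁻¹) * √(monomialSqNorm r n)) := by
            have := monomialSqNorm_pos (r := r) n
            gcongr
        _ = (1 + r⁻¹) * (‖ζ‖ ^ n / √(monomialSqNorm r n)) := by
            rw [← Real.sq_sqrt (monomialSqNorm_pos (r := r) n).le, Real.sqrt_sq hw.le]
            field_simp

/-- The weight in the n-th coefficient of the kernel cancels the squared norm of zⁿ, leaving the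
Laurent series of f at z. -/
theorem inner_kernelLp_toLp {f : ℂ → ℂ} (hf : HolomorphicSmoothUpTo (annulus r) f) {z : ℂ}
    (hz : z ∈ annulus r) :
    inner ℂ (kernelLp r z) ((memLp_of_continuousOn hf.continuousOn 2).toLp f) = f z := by
  set G := (memLp_of_continuousOn hf.continuousOn 2).toLp f with hG
  have h1 := ((hasSum_kernelLp hz).mapL (innerSL ℂ G)).star
  simp only [innerSL_apply_apply] at h1
  have h2 := hasSum_laurentCoeff hr.out.1 hf.continuousOn hf.1 hz
  rw [← inner_conj_symm]
  refine h1.unique ?_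
  convert! h2 using 2 with n
  rw [inner_smul_right, star_mul', RCLike.star_def, inner_conj_symm,
    inner_monomialLp hf.continuousOn hf.1, map_div₀, map_zpow₀, Complex.conj_conj,
    Complex.conj_ofReal]
  have : (monomialSqNorm r n : ℂ) ≠ 0 := by exact_mod_cast (monomialSqNorm_pos n).ne'
  field_simp

theorem isSzegoKernel_annulusKernel :
    IsSzegoKernel (annulus r) (annulusArcLength r) (annulusKernel r) := by
  refine ⟨kernelLp r, fun ζ hζ => ⟨kernelLp_mem_hardySpace hζ, isHolomorphicExtension_kernelLp hζ⟩,
    fun z _ ζ _ => ?_, ?_⟩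
  · rw [annulusKernel, annulusKernel, Complex.conj_tsum]
    refine tsum_congr fun n => ?_
    rw [map_mul, map_div₀, map_zpow₀, map_zpow₀, Complex.conj_conj, Complex.conj_ofReal]
    ring
  · rintro F - e ⟨f, hf, hfF, hfe⟩ z hz
    rw [integral_conj_mul_eq_inner]
    -- Reproduction holds for each smooth approximant; both sides pass to the limit, one by L²
    -- continuity of the pairing, the other by convergence at z.
    have h1 : Tendsto (fun k => (memLp_of_continuousOn (hf k).continuousOn 2).toLp (f k)) atTop
        (𝓝 F) := by
      rw [Lp.tendsto_Lp_iff_tendsto_eLpNorm']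
      refine hfF.congr fun k => eLpNorm_congr_ae ?_
      filter_upwards [(memLp_of_continuousOn (hf k).continuousOn 2).coeFn_toLp] with w hw
      rw [Pi.sub_apply, hw]
    have h2 := ((continuous_const (y := kernelLp r z)).inner (𝕜 := ℂ) continuous_id).tendsto F
    have h3 := h2.comp h1
    refine tendsto_nhds_unique (hfe.tendsto_at hz) (h3.congr fun k => ?_)
    exact inner_kernelLp_toLp (hf k) hz

end

/-! ### The logarithm of the q-Pochhammer symbol -/

/-- The logarithm `∑ log (1 - q ^ n y)` of the `q`-Pochhammer symbol `(y; q)_∞`. -/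
def logQPochhammer (q : ℝ) (y : ℂ) : ℂ := ∑' n : ℕ, Complex.log (1 - (q : ℂ) ^ n * y)

theorem norm_pow_mul_le {q : ℝ} (h0 : 0 < q) (h1 : q < 1) (n : ℕ) (y : ℂ) : ‖(q : ℂ) ^ n * y‖ ≤ ‖y‖ := by
  rw [norm_mul, norm_pow, Complex.norm_real, Real.norm_of_nonneg h0.le]
  exact mul_le_of_le_one_left (norm_nonneg _) (pow_le_one₀ h0.le h1.le)

/-- A geometric majorant uniform on |y| < ρ, from |log(1+u)| ≤ |u| + |u|²/(2(1-|u|)) with |u|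
bounded both by ρ and by qⁿ. It permits termwise differentiation. -/
theorem norm_log_one_sub_pow_mul_le {q : ℝ} (h0 : 0 < q) (h1 : q < 1)
    {ρ : ℝ} (hρ : ρ < 1) (n : ℕ) {y : ℂ} (hy : ‖y‖ < ρ) :
    ‖Complex.log (1 - (q : ℂ) ^ n * y)‖ ≤ ((1 - ρ)⁻¹ + 1) * q ^ n := by
  have h2 : ‖-((q : ℂ) ^ n * y)‖ ≤ ‖y‖ := by rw [norm_neg]; exact norm_pow_mul_le h0 h1 n y
  have h3 : ‖-((q : ℂ) ^ n * y)‖ ≤ q ^ n := by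
    rw [norm_neg, norm_mul, norm_pow, Complex.norm_real, Real.norm_of_nonneg h0.le]
    exact mul_le_of_le_one_right (by positivity) (hy.trans hρ).le
  have h4 := Complex.norm_log_one_add_le (z := -((q : ℂ) ^ n * y)) (by linarith)
  rw [← sub_eq_add_neg] at h4
  set t := ‖-((q : ℂ) ^ n * y)‖ with ht
  have ht0 : 0 ≤ t := norm_nonneg _
  have hρ' : 0 < 1 - ρ := by linarith
  have h5 : (1 - t)⁻¹ ≤ (1 - ρ)⁻¹ := by gcongr; linarith
  have h6 : 0 < (1 - ρ)⁻¹ := by positivity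
  have h7 : t ^ 2 * (1 - t)⁻¹ / 2 ≤ t * (1 - ρ)⁻¹ := by
    have : t ^ 2 * (1 - t)⁻¹ ≤ t * (1 - ρ)⁻¹ := by
      rw [sq]
      have h8 : t * t ≤ t * 1 := by gcongr; linarith
      exact mul_le_mul (by linarith) h5 (inv_nonneg.2 (by linarith)) ht0
    have : 0 ≤ t * (1 - ρ)⁻¹ := by positivity
    linarith
  calc _ ≤ t ^ 2 * (1 - t)⁻¹ / 2 + t := h4
    _ ≤ ((1 - ρ)⁻¹ + 1) * t := by linarith
    _ ≤ _ := by gcongr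

theorem one_sub_pow_mul_mem_slitPlane {q : ℝ} (h0 : 0 < q) (h1 : q < 1)
    (n : ℕ) {y : ℂ} (hy : ‖y‖ < 1) :
    1 - (q : ℂ) ^ n * y ∈ Complex.slitPlane := by
  rw [sub_eq_add_neg]
  apply Complex.mem_slitPlane_of_norm_lt_one
  rw [norm_neg]
  exact (norm_pow_mul_le h0 h1 n y).trans_lt hy

theorem hasDerivAt_log_one_sub_pow_mul {q : ℝ} (h0 : 0 < q) (h1 : q < 1)
    (n : ℕ) {y : ℂ} (hy : ‖y‖ < 1) :
    HasDerivAt (fun y => Complex.log (1 - (q : ℂ) ^ n * y))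
      (-(q : ℂ) ^ n / (1 - (q : ℂ) ^ n * y)) y := by
  have h := ((hasDerivAt_id y).const_mul ((q : ℂ) ^ n)).const_sub 1
  simpa using h.clog (one_sub_pow_mul_mem_slitPlane h0 h1 n hy)

theorem summable_const_mul_pow {q : ℝ} (h0 : 0 < q) (h1 : q < 1) (C : ℝ) : Summable fun n : ℕ => C * q ^ n :=
  (summable_geometric_of_lt_one h0.le h1).mul_left C

theorem differentiableOn_logQPochhammer {q : ℝ} (h0 : 0 < q) (h1 : q < 1)
    {ρ : ℝ} (hρ : ρ < 1) :
    DifferentiableOn ℂ (logQPochhammer q) (Metric.ball 0 ρ) := by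
  refine Complex.differentiableOn_tsum_of_summable_norm
    (summable_const_mul_pow h0 h1 ((1 - ρ)⁻¹ + 1)) (fun n y hy => ?_) Metric.isOpen_ball
    fun n y hy => norm_log_one_sub_pow_mul_le h0 h1 hρ n (by simpa using hy)
  have hy' : ‖y‖ < 1 := lt_trans (by simpa using hy) hρ
  exact (hasDerivAt_log_one_sub_pow_mul h0 h1 n hy').differentiableAt.differentiableWithinAt

theorem analyticAt_logQPochhammer {q : ℝ} (h0 : 0 < q) (h1 : q < 1)
    {y : ℂ} (hy : ‖y‖ < 1) : AnalyticAt ℂ (logQPochhammer q) y := by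
  obtain ⟨ρ, h2, h3⟩ := exists_between hy
  exact (differentiableOn_logQPochhammer h0 h1 h3).analyticAt
    (Metric.isOpen_ball.mem_nhds (by simpa using h2))

/-- The term n = 0 splits off: (y;q)_∞ = (1-y)(qy;q)_∞. After exponentiation no branch of the
logarithm matters. -/
theorem exp_logQPochhammer {q : ℝ} (h0 : 0 < q) (h1 : q < 1) {y : ℂ} (hy : ‖y‖ < 1) :
    Complex.exp (logQPochhammer q y) = (1 - y) * Complex.exp (logQPochhammer q (q * y)) := by
  obtain ⟨ρ, h2, h3⟩ := exists_between hy
  have hs : Summable fun n : ℕ => Complex.log (1 - (q : ℂ) ^ n * y) :=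
    Summable.of_norm_bounded (summable_const_mul_pow h0 h1 _)
      fun n => norm_log_one_sub_pow_mul_le h0 h1 h3 n h2
  have hne : 1 - y ≠ 0 := sub_ne_zero.2 fun h => by simp [← h] at hy
  rw [logQPochhammer, hs.tsum_eq_zero_add, Complex.exp_add, pow_zero, one_mul,
    Complex.exp_log hne, logQPochhammer]
  simp only [pow_succ, mul_assoc]

theorem hasSum_deriv_logQPochhammer {q : ℝ} (h0 : 0 < q) (h1 : q < 1)
    {y : ℂ} (hy : ‖y‖ < 1) :
    HasSum (fun n : ℕ => -(q : ℂ) ^ n / (1 - (q : ℂ) ^ n * y)) (deriv (logQPochhammer q) y) := by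
  obtain ⟨ρ, h2, h3⟩ := exists_between hy
  have h := Complex.hasSum_deriv_of_summable_norm
    (F := fun (n : ℕ) y => Complex.log (1 - (q : ℂ) ^ n * y)) (z := y) (U := Metric.ball 0 ρ)
    (summable_const_mul_pow h0 h1 ((1 - ρ)⁻¹ + 1)) (fun n y hy => ?_) Metric.isOpen_ball
    (fun n y hy => norm_log_one_sub_pow_mul_le h0 h1 h3 n (by simpa using hy)) (by simpa using h2)
  · convert! h using 2 with n
    exact (hasDerivAt_log_one_sub_pow_mul h0 h1 n hy).deriv.symm
  · have hy' : ‖y‖ < 1 := lt_trans (by simpa using hy) h3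
    exact (hasDerivAt_log_one_sub_pow_mul h0 h1 n hy').differentiableAt.differentiableWithinAt

/-! ### The squared Euler operator -/

/-- The operator `(x d/dx)²`. -/
def eulerSq (F : ℂ → ℂ) (x : ℂ) : ℂ := x * deriv (fun y => y * deriv F y) x

theorem eulerSq_eq {F : ℂ → ℂ} {x : ℂ} (hF : AnalyticAt ℂ F x) :
    eulerSq F x = x * (deriv F x + x * deriv (deriv F) x) := by
  have h := (hasDerivAt_id x).mul hF.deriv.differentiableAt.hasDerivAt
  have h' : HasDerivAt (fun y => y * deriv F y) (1 * deriv F x + x * deriv (deriv F) x) x := h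
  rw [eulerSq, h'.deriv, one_mul]

theorem eulerSq_add {F G : ℂ → ℂ} {x : ℂ} (hF : AnalyticAt ℂ F x) (hG : AnalyticAt ℂ G x) :
    eulerSq (fun y => F y + G y) x = eulerSq F x + eulerSq G x := by
  have h : ∀ᶠ y in 𝓝 x, deriv (fun y => F y + G y) y = deriv F y + deriv G y := by
    filter_upwards [hF.eventually_analyticAt, hG.eventually_analyticAt] with y h1 h2
    exact deriv_fun_add h1.differentiableAt h2.differentiableAt
  rw [eulerSq_eq (hF.fun_add hG), eulerSq_eq hF, eulerSq_eq hG, h.self_of_nhds,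
    EventuallyEq.deriv_eq h, deriv_fun_add hF.deriv.differentiableAt hG.deriv.differentiableAt]
  ring

theorem eulerSq_sub {F G : ℂ → ℂ} {x : ℂ} (hF : AnalyticAt ℂ F x) (hG : AnalyticAt ℂ G x) :
    eulerSq (fun y => F y - G y) x = eulerSq F x - eulerSq G x := by
  have h : ∀ᶠ y in 𝓝 x, deriv (fun y => F y - G y) y = deriv F y - deriv G y := by
    filter_upwards [hF.eventually_analyticAt, hG.eventually_analyticAt] with y h1 h2
    exact deriv_fun_sub h1.differentiableAt h2.differentiableAt
  rw [eulerSq_eq (hF.fun_sub hG), eulerSq_eq hF, eulerSq_eq hG, h.self_of_nhds,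
    EventuallyEq.deriv_eq h, deriv_fun_sub hF.deriv.differentiableAt hG.deriv.differentiableAt]
  ring

theorem eulerSq_comp_mul (F : ℂ → ℂ) (a x : ℂ) :
    eulerSq (fun y => F (a * y)) x = eulerSq F (a * x) := by
  have h : (fun y => y * deriv (fun y => F (a * y)) y) =
      fun y => (fun w => w * deriv F w) (a * y) := by
    funext y
    rw [deriv_comp_mul_left, smul_eq_mul]
    ring
  rw [eulerSq, h, deriv_comp_mul_left a (fun w => w * deriv F w), eulerSq, smul_eq_mul]
  ring

theorem hasDerivAt_comp_const_div {F : ℂ → ℂ} {a x : ℂ} (hx : x ≠ 0)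
    (hF : DifferentiableAt ℂ F (a / x)) :
    HasDerivAt (fun y => F (a / y)) (deriv F (a / x) * (-a / x ^ 2)) x := by
  have h1 : HasDerivAt (fun y => a / y) (-a / x ^ 2) x := by
    convert! (hasDerivAt_const x a).div (hasDerivAt_id x) hx using 1
    simp
  exact hF.hasDerivAt.comp x h1

/-- The inversion x ↦ a/x reverses the sign of x d/dx, hence preserves its square. -/
theorem eulerSq_comp_const_div {F : ℂ → ℂ} {a x : ℂ} (hx : x ≠ 0) (hF : AnalyticAt ℂ F (a / x)) :
    eulerSq (fun y => F (a / y)) x = eulerSq F (a / x) := by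
  have hc : ContinuousAt (fun y => a / y) x := continuousAt_const.div continuousAt_id hx
  have h : (fun y => y * deriv (fun y => F (a / y)) y) =ᶠ[𝓝 x]
      fun y => (fun w => -(w * deriv F w)) (a / y) := by
    filter_upwards [hc.eventually hF.eventually_analyticAt, eventually_ne_nhds hx] with y h1 h2
    rw [(hasDerivAt_comp_const_div h2 h1.differentiableAt).deriv]
    field_simp
  have hd : DifferentiableAt ℂ (fun w => w * deriv F w) (a / x) :=
    differentiableAt_id.mul hF.deriv.differentiableAt
  rw [eulerSq, h.deriv_eq, (hasDerivAt_comp_const_div hx hd.fun_neg).deriv, deriv.fun_neg, eulerSq]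
  field_simp

theorem eulerSq_log_one_sub {y : ℂ} (hy : 1 - y ∈ Complex.slitPlane) :
    eulerSq (fun y => Complex.log (1 - y)) y = -(y / (1 - y) ^ 2) := by
  have h0 : 1 - y ≠ 0 := Complex.slitPlane_ne_zero hy
  have h : (fun y => y * deriv (fun y => Complex.log (1 - y)) y) =ᶠ[𝓝 y] fun y => -y / (1 - y) := by
    have hc : ContinuousAt (fun y : ℂ => 1 - y) y := by fun_prop
    filter_upwards [hc.eventually (Complex.isOpen_slitPlane.mem_nhds hy)] with w hw
    have h1 : HasDerivAt (fun y : ℂ => 1 - y) (-1) w := (hasDerivAt_id w).const_sub 1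
    rw [(h1.clog hw).deriv]
    ring
  have h2 : HasDerivAt (fun y : ℂ => -y / (1 - y)) (-1 / (1 - y) ^ 2) y := by
    have := ((hasDerivAt_id y).neg).div ((hasDerivAt_id y).const_sub 1) h0
    convert! this using 1
    simp
  rw [eulerSq, h.deriv_eq, h2.deriv]
  ring

theorem hasSum_eulerSq_logQPochhammer {q : ℝ} (h0 : 0 < q) (h1 : q < 1) {y : ℂ} (hy : ‖y‖ < 1) :
    HasSum (fun n : ℕ => -((q : ℂ) ^ n * y / (1 - (q : ℂ) ^ n * y) ^ 2))
      (eulerSq (logQPochhammer q) y) := by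
  obtain ⟨ρ, h2, h3⟩ := exists_between hy
  have hρ : 0 < 1 - ρ := by linarith
  have hne : ∀ (n : ℕ) {w : ℂ}, ‖w‖ < 1 → 1 - (q : ℂ) ^ n * w ≠ 0 := fun n w hw =>
    Complex.slitPlane_ne_zero (one_sub_pow_mul_mem_slitPlane h0 h1 n hw)
  have hd : ∀ (n : ℕ) {w : ℂ}, ‖w‖ < 1 →
      HasDerivAt (fun w => -((q : ℂ) ^ n * w) / (1 - (q : ℂ) ^ n * w))
        (-(q : ℂ) ^ n / (1 - (q : ℂ) ^ n * w) ^ 2) w := by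
    intro n w hw
    have h4 := (hasDerivAt_id w).const_mul ((q : ℂ) ^ n)
    have := h4.neg.div (h4.const_sub 1) (hne n hw)
    convert! this using 1
    simp only [id, Pi.neg_apply]
    ring
  -- Only one more termwise derivative is needed: the first is `hasSum_deriv_logQPochhammer`,
  -- multiplied by w.
  have h := Complex.hasSum_deriv_of_summable_norm
    (F := fun (n : ℕ) w => -((q : ℂ) ^ n * w) / (1 - (q : ℂ) ^ n * w)) (z := y)
    (U := Metric.ball 0 ρ) (summable_const_mul_pow h0 h1 ((1 - ρ)⁻¹)) (fun n w hw => ?_)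
    Metric.isOpen_ball (fun n w hw => ?_) (by simpa using h2)
  · have he : (fun w => w * deriv (logQPochhammer q) w) =ᶠ[𝓝 y]
        fun w => ∑' n : ℕ, -((q : ℂ) ^ n * w) / (1 - (q : ℂ) ^ n * w) := by
      filter_upwards [(isOpen_lt continuous_norm continuous_const).mem_nhds hy] with w hw
      rw [← (hasSum_deriv_logQPochhammer h0 h1 hw).tsum_eq, ← tsum_mul_left]
      refine tsum_congr fun n => ?_
      ring
    rw [eulerSq, he.deriv_eq]
    convert! h.mul_left y using 2 with n
    rw [(hd n hy).deriv]
    ring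
  · have hw' : ‖w‖ < 1 := lt_trans (by simpa using hw) h3
    exact (hd n hw').differentiableAt.differentiableWithinAt
  · have hw' : ‖w‖ < ρ := by simpa using hw
    have h5 := norm_pow_mul_le h0 h1 n w
    have h6 : 1 - ρ ≤ ‖1 - (q : ℂ) ^ n * w‖ := by
      have := norm_sub_norm_le 1 ((q : ℂ) ^ n * w)
      rw [norm_one] at this
      linarith
    rw [norm_div, norm_neg, div_eq_inv_mul]
    gcongr
    rw [norm_mul, norm_pow, Complex.norm_real, Real.norm_of_nonneg h0.le]
    exact mul_le_of_le_one_right (by positivity) (hw'.trans h3).le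

/-! ### The theta quotient and its Laurent series -/

/-- Residue theorem for a simple pole at `1` of a function on an annulus. -/
theorem circleIntegral_sub_circleIntegral_of_simple_pole {k : ℂ → ℂ} {a b ρ₁ ρ₂ : ℝ}
    (hk : DifferentiableOn ℂ k {z | a < ‖z‖ ∧ ‖z‖ < b}) (h0 : 0 < ρ₁) (ha : a < ρ₁) (h1 : ρ₁ < 1)
    (h2 : 1 < ρ₂) (hb : ρ₂ < b) :
    (∮ z in C(0, ρ₂), (z - 1)⁻¹ * k z) - (∮ z in C(0, ρ₁), (z - 1)⁻¹ * k z) =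
      2 * Real.pi * Complex.I * k 1 := by
  set U : Set ℂ := {z | a < ‖z‖ ∧ ‖z‖ < b}
  have hU : IsOpen U :=
    (isOpen_lt continuous_const continuous_norm).inter (isOpen_lt continuous_norm continuous_const)
  have h1U : (1 : ℂ) ∈ U := ⟨by simpa using ha.trans h1, by simpa using h2.trans hb⟩
  -- Since k(z)/(z-1) = `dslope k 1 z` + k(1)/(z-1), the holomorphic part has equal integrals on
  -- both circles, and only the explicit pole distinguishes them.
  have hd : DifferentiableOn ℂ (dslope k 1) U :=
    (Complex.differentiableOn_dslope (hU.mem_nhds h1U)).2 hk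
  have hsub : Metric.closedBall (0 : ℂ) ρ₂ \ Metric.ball 0 ρ₁ ⊆ U := by
    intro z hz
    have hz' : ‖z‖ ≤ ρ₂ ∧ ρ₁ ≤ ‖z‖ := by simpa using hz
    exact ⟨ha.trans_le hz'.2, hz'.1.trans_lt hb⟩
  have hcong : (∮ z in C(0, ρ₂), dslope k 1 z) = ∮ z in C(0, ρ₁), dslope k 1 z :=
    Complex.circleIntegral_eq_of_differentiable_on_annulus_off_countable h0 (h1.trans h2).le
      Set.countable_empty (hd.continuousOn.mono hsub) fun z hz =>
        hd.differentiableAt (hU.mem_nhds (hsub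
          ⟨Metric.ball_subset_closedBall hz.1.1, fun h => hz.1.2 (Metric.ball_subset_closedBall h)⟩))
  have key : ∀ ρ : ℝ, 0 < ρ → a < ρ → ρ < b → ρ ≠ 1 →
      (∮ z in C(0, ρ), (z - 1)⁻¹ * k z) =
        (∮ z in C(0, ρ), dslope k 1 z) + k 1 * ∮ z in C(0, ρ), (z - 1)⁻¹ := by
    intro ρ hρ0 hρa hρb hρ
    have hne : ∀ z ∈ Metric.sphere (0 : ℂ) ρ, z ≠ 1 := by
      rintro z hz rfl
      exact hρ (by simpa using hz.symm)
    have hmem : Metric.sphere (0 : ℂ) ρ ⊆ U := fun z hz => by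
      have : ‖z‖ = ρ := by simpa using hz
      exact ⟨this ▸ hρa, this ▸ hρb⟩
    have hinv : ContinuousOn (fun z : ℂ => k 1 * (z - 1)⁻¹) (Metric.sphere 0 ρ) :=
      continuousOn_const.mul
        ((continuousOn_id.sub continuousOn_const).inv₀ fun z hz => sub_ne_zero.2 (hne z hz))
    rw [← circleIntegral.integral_const_mul, ← circleIntegral.integral_add
      ((hd.continuousOn.mono hmem).circleIntegrable hρ0.le)
      (hinv.circleIntegrable hρ0.le)]
    refine circleIntegral.integral_congr hρ0.le fun z hz => ?_
    rw [dslope_of_ne _ (hne z hz), slope_def_field]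
    ring
  have hz : (∮ z in C(0, ρ₁), (z - 1 : ℂ)⁻¹) = 0 := by
    have hne : ∀ z ∈ Metric.closedBall (0 : ℂ) ρ₁, z - 1 ≠ 0 := by
      intro z hz h
      have : ‖z‖ ≤ ρ₁ := by simpa using hz
      rw [sub_eq_zero.1 h, norm_one] at this
      linarith
    exact Complex.circleIntegral_eq_zero_of_differentiable_on_off_countable h0.le
      Set.countable_empty ((continuousOn_id.sub continuousOn_const).inv₀ hne) fun z hz =>
        (differentiableAt_id.sub_const 1).inv (hne z (Metric.ball_subset_closedBall hz.1))
  rw [key ρ₂ (h0.trans (h1.trans h2)) (ha.trans (h1.trans h2)) hb h2.ne',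
    key ρ₁ h0 ha (h1.trans (h2.trans hb)) h1.ne, hz,
    circleIntegral.integral_sub_inv_of_mem_ball (by simpa using h2), hcong]
  ring

/-- The power z⁻ⁿ contributes qⁿ under z ↦ z/q; the multiplier of f contributes c. -/
theorem laurentCoeff_scale {f : ℂ → ℂ} {c : ℂ} {ρ q : ℝ}
    (hf : ∀ z, ‖z‖ = ρ → f (z / q) = c * f z) (hρ : 0 < ρ) (n : ℤ) :
    laurentCoeff f (ρ / q) n = c * q ^ n * laurentCoeff f ρ n := by
  rw [laurentCoeff, laurentCoeff, mul_left_comm]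
  congr 1
  rw [← intervalIntegral.integral_const_mul]
  apply intervalIntegral.integral_congr
  intro t _
  have h : circleMap 0 (ρ / q) t = circleMap 0 ρ t / q := by
    simp only [circleMap, zero_add]
    push_cast
    ring
  simp only [h]
  rw [hf _ (by simp [abs_of_pos hρ]), div_zpow, zpow_neg (q : ℂ), div_inv_eq_mul]
  ring

/-- `(1 - x)` times the quotient `θ(-r x) / θ(x)` of theta functions with nome `r²`. -/
def thetaQuotient (r : ℝ) (x : ℂ) : ℂ :=
  (1 + r * x) * (1 + r / x) *
    Complex.exp (logQPochhammer (r ^ 2) (-r ^ 3 * x) + logQPochhammer (r ^ 2) (-r ^ 3 / x) -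
      logQPochhammer (r ^ 2) (r ^ 2 * x) - logQPochhammer (r ^ 2) (r ^ 2 / x))

section

variable {r : ℝ} [hr : Fact (r ∈ Set.Ioo (0 : ℝ) 1)]

theorem sq_mem_Ioo : 0 < r ^ 2 ∧ r ^ 2 < 1 := by
  have h0 := hr.out.1
  have h1 := hr.out.2
  constructor <;> nlinarith

theorem analyticAt_logQPochhammer_sq {y : ℂ} (hy : ‖y‖ < 1) :
    AnalyticAt ℂ (logQPochhammer (r ^ 2)) y :=
  analyticAt_logQPochhammer (sq_mem_Ioo (r := r)).1 (sq_mem_Ioo (r := r)).2 hy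

/-- With the factors vanishing at x = -1/r, x = -r and x = 1 kept outside the logarithms, the
remaining arguments stay in the unit disc on an annulus that contains both circles |x| = ρ and |x| =
ρ/r². -/
theorem norm_thetaQuotient_args {x : ℂ} (h1 : r ^ 2 < ‖x‖) (h2 : ‖x‖ < (r ^ 2)⁻¹) :
    ‖-(r : ℂ) ^ 3 * x‖ < 1 ∧ ‖-(r : ℂ) ^ 3 / x‖ < 1 ∧ ‖(r : ℂ) ^ 2 * x‖ < 1 ∧
      ‖(r : ℂ) ^ 2 / x‖ < 1 := by
  have h0 := hr.out.1
  have h3 : 0 < r ^ 2 := by positivity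
  have hx : 0 < ‖x‖ := h3.trans h1
  have h4 : r ^ 3 < r ^ 2 := by nlinarith [hr.out.2]
  have h5 : r ^ 2 * ‖x‖ < 1 := by
    rw [lt_inv_comm₀ hx h3] at h2
    calc r ^ 2 * ‖x‖ < ‖x‖⁻¹ * ‖x‖ := by gcongr
      _ = 1 := inv_mul_cancel₀ hx.ne'
  have h6 : r ^ 3 * ‖x‖ ≤ r ^ 2 * ‖x‖ := by gcongr
  simp only [norm_mul, norm_div, norm_neg, norm_pow, Complex.norm_real, Real.norm_of_nonneg h0.le]
  refine ⟨by linarith, ?_, h5, ?_⟩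
  · rw [div_lt_one hx]; linarith
  · rwa [div_lt_one hx]

theorem differentiableOn_thetaQuotient :
    DifferentiableOn ℂ (thetaQuotient r) {z | r ^ 2 < ‖z‖ ∧ ‖z‖ < (r ^ 2)⁻¹} := by
  intro x hx
  have hx0 : x ≠ 0 := norm_pos_iff.1 ((sq_nonneg r).trans_lt hx.1)
  obtain ⟨h1, h2, h3, h4⟩ := norm_thetaQuotient_args hx.1 hx.2
  have d : ∀ {y : ℂ}, ‖y‖ < 1 → DifferentiableAt ℂ (logQPochhammer (r ^ 2)) y :=
    fun hy => (analyticAt_logQPochhammer_sq hy).differentiableAt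
  have dm : ∀ a : ℂ, DifferentiableAt ℂ (fun x => a * x) x := fun a => by fun_prop
  have dd : ∀ a : ℂ, DifferentiableAt ℂ (fun x => a / x) x := fun a =>
    (differentiableAt_const a).div differentiableAt_id hx0
  have e := ((((d h1).comp x (dm _)).add ((d h2).comp x (dd _))).sub ((d h3).comp x (dm _))).sub
    ((d h4).comp x (dd _))
  exact ((((dm r).const_add 1).mul ((dd r).const_add 1)).mul e.cexp).differentiableWithinAt

theorem thetaQuotient_one_ne_zero : thetaQuotient r 1 ≠ 0 := by
  have h0 := hr.out.1
  have h : (1 + r : ℂ) ≠ 0 := by exact_mod_cast (by positivity : (1 + r) ≠ 0)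
  simp [thetaQuotient, h]

theorem exp_logQPochhammer_sq {y : ℂ} (hy : ‖y‖ < 1) :
    Complex.exp (logQPochhammer (r ^ 2) y) =
      (1 - y) * Complex.exp (logQPochhammer (r ^ 2) (r ^ 2 * y)) := by
  simpa using exp_logQPochhammer (sq_mem_Ioo (r := r)).1 (sq_mem_Ioo (r := r)).2 hy

/-- Under x ↦ x/r² each infinite product gains or loses one factor; these factors combine to -r.
This quasi-periodicity determines the Laurent coefficients. -/
theorem thetaQuotient_div_sq {x : ℂ} (h1 : r ^ 2 < ‖x‖) (h2 : ‖x‖ < 1) :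
    thetaQuotient r (x / (r ^ 2 : ℝ)) / (1 - x / (r ^ 2 : ℝ)) =
      -r * (thetaQuotient r x / (1 - x)) := by
  have h0 := hr.out.1
  have hr0 : (r : ℂ) ≠ 0 := by exact_mod_cast h0.ne'
  have hx0 : x ≠ 0 := norm_pos_iff.1 ((sq_nonneg r).trans_lt h1)
  have hx1 : 1 - x ≠ 0 := sub_ne_zero.2 fun h => by simp [← h] at h2
  have hxr : (r : ℂ) ^ 2 - x ≠ 0 := by
    refine sub_ne_zero.2 fun h => ?_
    rw [← h, norm_pow, Complex.norm_real, Real.norm_of_nonneg h0.le] at h1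
    exact h1.false
  have hinv : ‖x‖ < (r ^ 2)⁻¹ := h2.trans (one_lt_inv_iff₀.2 sq_mem_Ioo)
  obtain ⟨-, n2, -, n4⟩ := norm_thetaQuotient_args h1 hinv
  have n1 : ‖-(r : ℂ) * x‖ < 1 := by
    rw [norm_mul, norm_neg, Complex.norm_real, Real.norm_of_nonneg h0.le]
    nlinarith [hr.out.2, norm_nonneg x]
  have e1 := exp_logQPochhammer_sq (r := r) n1
  have e2 := exp_logQPochhammer_sq (r := r) n2
  have e3 := exp_logQPochhammer_sq (r := r) h2
  have e4 := exp_logQPochhammer_sq (r := r) n4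
  have a1 : -(r : ℂ) ^ 3 * (x / (r ^ 2 : ℝ)) = -r * x := by push_cast; field_simp
  have a2 : -(r : ℂ) ^ 3 / (x / (r ^ 2 : ℝ)) = r ^ 2 * (-r ^ 3 / x) := by push_cast; field_simp
  have a3 : (r : ℂ) ^ 2 * (x / (r ^ 2 : ℝ)) = x := by push_cast; field_simp
  have a4 : (r : ℂ) ^ 2 / (x / (r ^ 2 : ℝ)) = r ^ 2 * (r ^ 2 / x) := by push_cast; field_simp
  have a5 : (r : ℂ) ^ 2 * (-r * x) = -r ^ 3 * x := by ring
  rw [a5] at e1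
  unfold thetaQuotient
  rw [a1, a2, a3, a4]
  simp only [Complex.exp_sub, Complex.exp_add]
  rw [e1, e2, e3, e4]
  have E : ∀ y, Complex.exp (logQPochhammer (r ^ 2) y) ≠ 0 := fun y => Complex.exp_ne_zero _
  generalize Complex.exp (logQPochhammer (r ^ 2) (-r ^ 3 * x)) = X1 at *
  have E2 := E (r ^ 2 * (-r ^ 3 / x))
  have E3 := E (r ^ 2 * x)
  have E4 := E (r ^ 2 * (r ^ 2 / x))
  generalize Complex.exp (logQPochhammer (r ^ 2) (r ^ 2 * (-r ^ 3 / x))) = X2 at *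
  generalize Complex.exp (logQPochhammer (r ^ 2) (r ^ 2 * x)) = X3 at *
  generalize Complex.exp (logQPochhammer (r ^ 2) (r ^ 2 * (r ^ 2 / x))) = X4 at *
  have hxr' : 1 - x / ((r ^ 2 : ℝ) : ℂ) ≠ 0 := by
    push_cast
    rw [one_sub_div (pow_ne_zero 2 hr0)]
    exact div_ne_zero hxr (pow_ne_zero 2 hr0)
  have hxr'' : 1 - (r : ℂ) ^ 2 / x ≠ 0 := by
    rw [one_sub_div hx0]
    exact div_ne_zero (by rwa [← neg_sub, neg_ne_zero]) hx0
  have hxr3 : x - (r : ℂ) ^ 2 ≠ 0 := by rwa [← neg_sub, neg_ne_zero]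
  push_cast at hxr' ⊢
  field_simp
  ring

/-- The Laurent expansion `θ(-r x) / θ(x) = c ∑ xⁿ / (1 + r²ⁿ⁺¹)` on `r² < |x| < 1`. -/
theorem hasSum_thetaQuotient {x : ℂ} (h1 : r ^ 2 < ‖x‖) (h2 : ‖x‖ < 1) :
    HasSum (fun n : ℤ => thetaQuotient r 1 / (1 + r ^ (2 * n + 1)) * x ^ n)
      (thetaQuotient r x / (1 - x)) := by
  have h0 := hr.out.1
  have hr0 : (r : ℂ) ≠ 0 := by exact_mod_cast h0.ne'
  have hq := sq_mem_Ioo (r := r)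
  have hinv : 1 < (r ^ 2)⁻¹ := one_lt_inv_iff₀.2 hq
  obtain ⟨ρ, h3, h4⟩ := exists_between h2
  obtain ⟨a, h5, h6⟩ := exists_between h1
  have hρ0 : 0 < ρ := (norm_nonneg x).trans_lt h3
  have hd : DifferentiableOn ℂ (fun x => thetaQuotient r x / (1 - x)) {z | r ^ 2 < ‖z‖ ∧ ‖z‖ < 1} := by
    refine (differentiableOn_thetaQuotient.mono fun z hz => ⟨hz.1, hz.2.trans hinv⟩).div
      (by fun_prop) fun z hz => sub_ne_zero.2 fun h => ?_
    rw [← h] at hz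
    simpa using hz.2
  have hs := hasSum_laurentCoeff (f := fun x => thetaQuotient r x / (1 - x)) (a := a) (b := ρ)
    (hq.1.trans h5) (hd.continuousOn.mono fun z hz => ⟨h5.trans_le hz.1, hz.2.trans_lt h4⟩)
    (hd.mono fun z hz => ⟨h5.trans hz.1, hz.2.trans h4⟩) (z := x) ⟨h6, h3⟩
  convert! hs using 3 with n
  set f := fun x => thetaQuotient r x / (1 - x) with hf
  have hρ1 : r ^ 2 < ρ := h1.trans h3
  have hsc := laurentCoeff_scale (f := f) (c := -r) (ρ := ρ) (q := r ^ 2)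
    (fun z hz => thetaQuotient_div_sq (hz ▸ hρ1) (hz ▸ h4)) hρ0 n
  -- Writing 1/(1-z) as -1/(z-1) puts the coefficient in the form of the residue lemma and accounts
  -- for the sign.
  have hU : ∀ ρ' : ℝ, 0 < ρ' → laurentCoeff f ρ' n = -((2 * Real.pi * Complex.I)⁻¹ *
      ∮ z in C(0, ρ'), (z - 1)⁻¹ * (thetaQuotient r z * z ^ (-n - 1))) := by
    intro ρ' hρ'
    rw [laurentCoeff_eq_circleIntegral f hρ'.ne', ← mul_neg]
    congr 1
    rw [← neg_one_mul (∮ z in C(0, ρ'), (_ : ℂ)), ← circleIntegral.integral_const_mul]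
    refine circleIntegral.integral_congr hρ'.le fun z hz => ?_
    have hz0 : z ≠ 0 := by
      rintro rfl
      exact hρ'.ne (by simpa using hz)
    simp only [hf, sub_zero, smul_eq_mul]
    rw [zpow_sub_one₀ hz0, ← neg_sub z 1, div_neg, div_eq_mul_inv]
    ring
  have hres := circleIntegral_sub_circleIntegral_of_simple_pole
    (k := fun z => thetaQuotient r z * z ^ (-n - 1)) (a := r ^ 2) (b := (r ^ 2)⁻¹) (ρ₁ := ρ)
    (ρ₂ := ρ / r ^ 2) (differentiableOn_thetaQuotient.mul fun z hz =>
      (differentiableAt_zpow.2 (Or.inl (norm_pos_iff.1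
        (hq.1.trans hz.1)))).differentiableWithinAt) hρ0 hρ1 h4
    ((one_lt_div hq.1).2 hρ1) (by rw [div_eq_mul_inv]; exact mul_lt_of_lt_one_left (by positivity) h4)
  have hpi : (2 * Real.pi * Complex.I : ℂ) ≠ 0 := Complex.two_pi_I_ne_zero
  have hdiff : laurentCoeff f (ρ / r ^ 2) n - laurentCoeff f ρ n = -thetaQuotient r 1 := by
    rw [hU _ (by positivity), hU _ hρ0]
    have := congrArg (fun w => (2 * Real.pi * Complex.I : ℂ)⁻¹ * w) hres
    simp only [inv_mul_cancel_left₀ hpi, one_zpow, mul_one, mul_sub] at this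
    linear_combination -this
  -- This leaves (-r · r²ⁿ - 1) aₙ = -`thetaQuotient r 1` for the coefficient aₙ on |x| = ρ.
  rw [hsc] at hdiff
  have hpow : (r : ℂ) * ((r ^ 2 : ℝ) : ℂ) ^ n = r ^ (2 * n + 1) := by
    push_cast
    rw [zpow_add_one₀ hr0, zpow_mul, mul_comm]
    norm_cast
  have hne : (1 + (r : ℂ) ^ (2 * n + 1)) ≠ 0 := by
    have := zpow_pos h0 (2 * n + 1)
    exact_mod_cast (by positivity : 1 + r ^ (2 * n + 1) ≠ 0)
  rw [div_eq_iff hne, ← hpow]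
  linear_combination hdiff

end

/-! ### The Lambert type series and its positivity -/

section

/-- The Koebe function `y / (1 - y)²`. -/
def koebe (y : ℂ) : ℂ := y / (1 - y) ^ 2

/-- This symmetry folds the factors in 1/x into the negative indices of a series over ℤ. -/
theorem koebe_inv (y : ℂ) : koebe y⁻¹ = koebe y := by
  rcases eq_or_ne y 0 with rfl | hy
  · simp [koebe]
  have h : 1 - y⁻¹ = -(1 - y) / y := by field_simp; ring
  rw [koebe, koebe, h, div_pow, neg_sq, div_div_eq_mul_div]
  field_simp

/-- The terms of the Lambert type series `(x d/dx)² log (θ(-r x) / θ(x))`. -/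
def lambertTerm (r : ℝ) (x : ℂ) (n : ℤ) : ℂ :=
  koebe (((r ^ 2 : ℝ) : ℂ) ^ n * x) - koebe (-(((r ^ 2 : ℝ) : ℂ) ^ n * x) / r)

/-- The logarithm of `θ(-r x) / θ(x)`. -/
def logThetaQuotient (r : ℝ) (x : ℂ) : ℂ :=
  Complex.log (1 - -r * x) + Complex.log (1 - -r / x) - Complex.log (1 - x) +
    logQPochhammer (r ^ 2) (-r ^ 3 * x) + logQPochhammer (r ^ 2) (-r ^ 3 / x) -
    logQPochhammer (r ^ 2) (r ^ 2 * x) - logQPochhammer (r ^ 2) (r ^ 2 / x)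

variable {r : ℝ} [hr : Fact (r ∈ Set.Ioo (0 : ℝ) 1)]

theorem one_sub_mem_slitPlane_of_lt {x : ℝ} (hx : x < 1) : 1 - (x : ℂ) ∈ Complex.slitPlane := by
  left
  simpa using hx

theorem logThetaQuotient_args {x : ℝ} (h1 : r ^ 2 < x) (h2 : x < 1) :
    1 - -(r : ℂ) * x ∈ Complex.slitPlane ∧ 1 - -(r : ℂ) / x ∈ Complex.slitPlane ∧
      1 - (x : ℂ) ∈ Complex.slitPlane := by
  have h0 := hr.out.1
  have hx : 0 < x := (sq_nonneg r).trans_lt h1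
  have h3 : -r * x < 1 := by nlinarith
  have h4 : -r / x < 1 := (div_neg_of_neg_of_pos (by linarith) hx).trans one_pos
  exact ⟨by exact_mod_cast one_sub_mem_slitPlane_of_lt h3,
    by exact_mod_cast one_sub_mem_slitPlane_of_lt h4, one_sub_mem_slitPlane_of_lt h2⟩

theorem norm_thetaQuotient_args_ofReal {x : ℝ} (h1 : r ^ 2 < x) (h2 : x < 1) :
    ‖-(r : ℂ) ^ 3 * x‖ < 1 ∧ ‖-(r : ℂ) ^ 3 / x‖ < 1 ∧ ‖(r : ℂ) ^ 2 * x‖ < 1 ∧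
      ‖(r : ℂ) ^ 2 / x‖ < 1 := by
  have hx : 0 < x := (sq_nonneg r).trans_lt h1
  have hn : ‖(x : ℂ)‖ = x := by rw [Complex.norm_real, Real.norm_of_nonneg hx.le]
  exact norm_thetaQuotient_args (hn.symm ▸ h1)
    (hn.symm ▸ h2.trans (one_lt_inv_iff₀.2 sq_mem_Ioo))

theorem exp_logThetaQuotient {x : ℝ} (h1 : r ^ 2 < x) (h2 : x < 1) :
    Complex.exp (logThetaQuotient r x) = thetaQuotient r x / (1 - x) := by
  obtain ⟨s1, s2, s3⟩ := logThetaQuotient_args h1 h2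
  rw [logThetaQuotient, thetaQuotient]
  simp only [Complex.exp_sub, Complex.exp_add]
  rw [Complex.exp_log (Complex.slitPlane_ne_zero s1), Complex.exp_log (Complex.slitPlane_ne_zero s2),
    Complex.exp_log (Complex.slitPlane_ne_zero s3)]
  rw [neg_mul (r : ℂ), neg_div (x : ℂ) (r : ℂ), sub_neg_eq_add, sub_neg_eq_add]
  ring

theorem analyticAt_const_div {a x : ℂ} (hx : x ≠ 0) : AnalyticAt ℂ (fun y => a / y) x :=
  analyticAt_const.div analyticAt_id hx

theorem analyticAt_const_mul (a x : ℂ) : AnalyticAt ℂ (fun y => a * y) x :=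
  analyticAt_const.mul analyticAt_id

theorem analyticAt_log_one_sub {y : ℂ} (hy : 1 - y ∈ Complex.slitPlane) :
    AnalyticAt ℂ (fun y => Complex.log (1 - y)) y :=
  (analyticAt_const.sub analyticAt_id).clog hy

/-- Each factor of the product contributes one Koebe term, positive for the denominator θ(x) and
negative for the numerator θ(-rx). -/
theorem analyticAt_logThetaQuotient_and_hasSum {x : ℝ} (h1 : r ^ 2 < x) (h2 : x < 1) :
    AnalyticAt ℂ (logThetaQuotient r) x ∧
      HasSum (lambertTerm r x) (eulerSq (logThetaQuotient r) x) := by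
  have h0 := hr.out.1
  have hr0 : (r : ℂ) ≠ 0 := by exact_mod_cast h0.ne'
  have hx : (x : ℂ) ≠ 0 := by exact_mod_cast ((sq_nonneg r).trans_lt h1).ne'
  obtain ⟨s1, s2, s3⟩ := logThetaQuotient_args h1 h2
  obtain ⟨n1, n2, n3, n4⟩ := norm_thetaQuotient_args_ofReal h1 h2
  have A1 : AnalyticAt ℂ (fun y => Complex.log (1 - -r * y)) (x : ℂ) :=
    (analyticAt_log_one_sub s1).fun_comp (analyticAt_const_mul (-r) (x : ℂ))
  have A2 : AnalyticAt ℂ (fun y => Complex.log (1 - -r / y)) (x : ℂ) :=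
    (analyticAt_log_one_sub s2).fun_comp (analyticAt_const_div (a := -r) hx)
  have A3 := analyticAt_log_one_sub s3
  have A4 : AnalyticAt ℂ (fun y => logQPochhammer (r ^ 2) (-r ^ 3 * y)) (x : ℂ) :=
    (analyticAt_logQPochhammer_sq n1).fun_comp (analyticAt_const_mul (-r ^ 3) (x : ℂ))
  have A5 : AnalyticAt ℂ (fun y => logQPochhammer (r ^ 2) (-r ^ 3 / y)) (x : ℂ) :=
    (analyticAt_logQPochhammer_sq n2).fun_comp (analyticAt_const_div (a := -r ^ 3) hx)
  have A6 : AnalyticAt ℂ (fun y => logQPochhammer (r ^ 2) (r ^ 2 * y)) (x : ℂ) :=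
    (analyticAt_logQPochhammer_sq n3).fun_comp (analyticAt_const_mul (r ^ 2) (x : ℂ))
  have A7 : AnalyticAt ℂ (fun y => logQPochhammer (r ^ 2) (r ^ 2 / y)) (x : ℂ) :=
    (analyticAt_logQPochhammer_sq n4).fun_comp (analyticAt_const_div (a := r ^ 2) hx)
  have B2 := A1.fun_add A2
  have B3 := B2.fun_sub A3
  have B4 := B3.fun_add A4
  have B5 := B4.fun_add A5
  have B6 := B5.fun_sub A6
  refine ⟨B6.fun_sub A7, ?_⟩
  have hE : eulerSq (logThetaQuotient r) x = -koebe (-r * x) + -koebe (-r / x) - -koebe x +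
      eulerSq (logQPochhammer (r ^ 2)) (-r ^ 3 * x) +
      eulerSq (logQPochhammer (r ^ 2)) (-r ^ 3 / x) -
      eulerSq (logQPochhammer (r ^ 2)) (r ^ 2 * x) -
      eulerSq (logQPochhammer (r ^ 2)) (r ^ 2 / x) := by
    unfold logThetaQuotient
    rw [eulerSq_sub B6 A7, eulerSq_sub B5 A6, eulerSq_add B4 A5, eulerSq_add B3 A4,
      eulerSq_sub B2 A3, eulerSq_add A1 A2, eulerSq_comp_mul (fun y => Complex.log (1 - y)),
      eulerSq_comp_const_div (F := fun y => Complex.log (1 - y)) hx (analyticAt_log_one_sub s2),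
      eulerSq_comp_mul, eulerSq_comp_mul, eulerSq_comp_const_div hx (analyticAt_logQPochhammer_sq n2),
      eulerSq_comp_const_div hx (analyticAt_logQPochhammer_sq n4), eulerSq_log_one_sub s1,
      eulerSq_log_one_sub s2, eulerSq_log_one_sub s3]
    rfl
  have hq := sq_mem_Ioo (r := r)
  have S1 := hasSum_eulerSq_logQPochhammer hq.1 hq.2 n1
  have S2 := hasSum_eulerSq_logQPochhammer hq.1 hq.2 n2
  have S3 := hasSum_eulerSq_logQPochhammer hq.1 hq.2 n3
  have S4 := hasSum_eulerSq_logQPochhammer hq.1 hq.2 n4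
  have hq0 : ((r ^ 2 : ℝ) : ℂ) ≠ 0 := by exact_mod_cast hq.1.ne'
  have hneg : ∀ n : ℕ, ((r ^ 2 : ℝ) : ℂ) ^ (-((n : ℤ) + 1)) =
      (((r ^ 2 : ℝ) : ℂ) ^ n * r ^ 2)⁻¹ := by
    intro n
    rw [zpow_neg, zpow_add_one₀ hq0, zpow_natCast]
    push_cast
    rfl
  -- The denominator: `koebe x` is n = 0, the product in r²x gives n > 0, and the one in r²/x gives
  -- n < 0 after inversion.
  have Z1 : HasSum (fun n : ℤ => koebe (((r ^ 2 : ℝ) : ℂ) ^ n * x))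
      (koebe x + -eulerSq (logQPochhammer (r ^ 2)) (r ^ 2 * x) +
        -eulerSq (logQPochhammer (r ^ 2)) (r ^ 2 / x)) := by
    apply HasSum.of_nat_of_neg_add_one
    · have := (hasSum_nat_add_iff (f := fun n : ℕ => koebe (((r ^ 2 : ℝ) : ℂ) ^ (n : ℤ) * x))
        (g := -eulerSq (logQPochhammer (r ^ 2)) (r ^ 2 * x)) 1).1 (by
          convert! S3.neg using 2 with n
          rw [neg_neg, ← koebe, zpow_natCast, pow_succ]
          push_cast
          ring_nf)
      simpa [add_comm] using this
    · convert! S4.neg using 2 with n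
      rw [neg_neg, ← koebe, ← koebe_inv, hneg]
      congr 1
      field_simp
  have Z2 : HasSum (fun n : ℤ => koebe (-(((r ^ 2 : ℝ) : ℂ) ^ n * x) * r))
      ((koebe (-r * x) + -eulerSq (logQPochhammer (r ^ 2)) (-r ^ 3 * x)) +
        (koebe (-r / x) + -eulerSq (logQPochhammer (r ^ 2)) (-r ^ 3 / x))) := by
    apply HasSum.of_nat_of_neg_add_one
    · have := (hasSum_nat_add_iff (f := fun n : ℕ => koebe (-(((r ^ 2 : ℝ) : ℂ) ^ (n : ℤ) * x) * r))
        (g := -eulerSq (logQPochhammer (r ^ 2)) (-r ^ 3 * x)) 1).1 (by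
          convert! S1.neg using 2 with n
          rw [neg_neg, ← koebe, zpow_natCast, pow_succ]
          push_cast
          ring_nf)
      simpa [add_comm, mul_comm] using this
    · have := (hasSum_nat_add_iff
        (f := fun n : ℕ => koebe (-(((r ^ 2 : ℝ) : ℂ) ^ (-((n : ℤ) + 1)) * x) * r))
        (g := -eulerSq (logQPochhammer (r ^ 2)) (-r ^ 3 / x)) 1).1 (by
          convert! S2.neg using 2 with n
          rw [neg_neg, ← koebe, ← koebe_inv, hneg, pow_succ]
          congr 1
          push_cast
          field_simp)
      convert! this using 1
      rw [Finset.sum_range_one, hneg, ← koebe_inv (-(_ : ℂ) * r), add_comm]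
      congr 2
      push_cast
      field_simp
  have Z3 : HasSum (fun n : ℤ => koebe (-(((r ^ 2 : ℝ) : ℂ) ^ n * x) / r))
      ((koebe (-r * x) + -eulerSq (logQPochhammer (r ^ 2)) (-r ^ 3 * x)) +
        (koebe (-r / x) + -eulerSq (logQPochhammer (r ^ 2)) (-r ^ 3 / x))) := by
    -- Shifting n by one turns the factor r into r/r² = 1/r, the form that matches the half-period
    -- shift in ℘.
    rw [← (Equiv.subRight (1 : ℤ)).hasSum_iff] at Z2
    convert! Z2 using 2 with n
    simp only [Function.comp_apply, Equiv.subRight_apply]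
    rw [zpow_sub_one₀ hq0]
    congr 1
    push_cast
    field_simp
  convert! Z1.sub Z3 using 1
  rw [hE]
  ring

/-- On the real interval `(r², 1)` all terms of the Lambert type series are positive. -/
theorem exists_pos_lambertTerm {x : ℝ} (hx : 0 < x) (hn : ∀ n : ℤ, (r ^ 2) ^ n * x ≠ 1) (n : ℤ) :
    ∃ t : ℝ, 0 < t ∧ lambertTerm r x n = t := by
  have h0 := hr.out.1
  set y := (r ^ 2) ^ n * x with hy
  have hy0 : 0 < y := mul_pos (zpow_pos (by positivity) n) hx
  refine ⟨y / (1 - y) ^ 2 - -y / r / (1 - -y / r) ^ 2, ?_, ?_⟩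
  · have hne : 1 - y ≠ 0 := sub_ne_zero.2 (hn n).symm
    have h1 : 0 < (1 - y) ^ 2 := by positivity
    have h2 : 0 < 1 - -y / r := by rw [neg_div, sub_neg_eq_add]; positivity
    have h3 : -y / r / (1 - -y / r) ^ 2 < 0 :=
      div_neg_of_neg_of_pos (by rw [neg_div]; exact neg_neg_of_pos (by positivity)) (by positivity)
    have h4 : 0 < y / (1 - y) ^ 2 := by positivity
    linarith
  · rw [lambertTerm, koebe, koebe, hy]
    push_cast
    rfl

theorem eulerSq_logThetaQuotient_pos {x : ℝ} (h1 : r ^ 2 < x) (h2 : x < 1) :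
    ∃ t : ℝ, 0 < t ∧ eulerSq (logThetaQuotient r) x = t := by
  have h0 := hr.out.1
  have hq := sq_mem_Ioo (r := r)
  have hx : 0 < x := (sq_nonneg r).trans_lt h1
  -- As r² < x < 1, x lies strictly between consecutive powers of r², so no denominator vanishes.
  have hn : ∀ n : ℤ, (r ^ 2) ^ n * x ≠ 1 := by
    intro n hn
    rcases le_or_gt 0 n with h | h
    · have h3 : (r ^ 2) ^ n ≤ 1 := zpow_le_one₀ hq.1 hq.2.le h
      have h4 : (r ^ 2) ^ n * x ≤ 1 * x := by gcongr
      linarith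
    · have h3 : (r ^ 2) ^ (-1 : ℤ) ≤ (r ^ 2) ^ n :=
        zpow_le_zpow_right_of_le_one₀ hq.1 hq.2.le (by omega)
      have h4 : (r ^ 2) ^ (-1 : ℤ) * r ^ 2 < (r ^ 2) ^ n * x :=
        mul_lt_mul' h3 h1 hq.1.le (zpow_pos hq.1 n)
      rw [zpow_neg_one, inv_mul_cancel₀ hq.1.ne'] at h4
      linarith
  choose t ht0 ht using exists_pos_lambertTerm (r := r) hx hn
  have hs := (analyticAt_logThetaQuotient_and_hasSum h1 h2).2
  rw [funext ht] at hs
  have hs' : HasSum t (eulerSq (logThetaQuotient r) x).re := by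
    simpa using Complex.hasSum_re hs
  refine ⟨_, ?_, hs.unique (Complex.hasSum_ofReal.2 hs')⟩
  exact (ht0 0).trans_le (le_hasSum hs' 0 fun n _ => (ht0 n).le)

end

/-! ### Row sums of the Weierstrass function -/

/-- Lipschitz's formula at v/(2πi), which lies in the upper half-plane exactly when Re v < 0,
together with ∑ n yⁿ = y/(1-y)². -/
theorem hasSum_one_div_sq_of_re_neg {v : ℂ} (hv : v.re < 0) :
    HasSum (fun n : ℤ => 1 / (v + n * (2 * Real.pi * Complex.I)) ^ 2) (koebe (Complex.exp v)) := by
  have hpi : (2 * Real.pi * Complex.I : ℂ) ≠ 0 := Complex.two_pi_I_ne_zero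
  have hpos := Real.pi_pos
  set z : ℂ := v / (2 * Real.pi * Complex.I) with hz
  have him : 0 < z.im := by
    have h : z = (((2 * Real.pi)⁻¹ : ℝ) : ℂ) * (v * -Complex.I) := by
      rw [hz, div_eq_mul_inv, mul_inv, Complex.inv_I]
      push_cast
      ring
    rw [h, Complex.im_ofReal_mul]
    have : (v * -Complex.I).im = -v.re := by simp
    rw [this]
    exact mul_pos (by positivity) (neg_pos.2 hv)
  have hid := EisensteinSeries.qExpansion_identity (k := 1) le_rfl ⟨z, him⟩
  have hexp : Complex.exp (2 * Real.pi * Complex.I * z) = Complex.exp v := by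
    rw [hz, mul_div_cancel₀ _ hpi]
  have hnorm : ‖Complex.exp v‖ < 1 := by
    rw [Complex.norm_exp]
    exact Real.exp_lt_one_iff.2 hv
  simp only [Nat.reduceAdd, pow_one, Nat.factorial_one, Nat.cast_one,
    div_one, hexp, tsum_coe_mul_geometric_of_norm_lt_one hnorm] at hid
  have hsum : Summable fun n : ℤ => 1 / (z + n) ^ 2 := by
    have := EisensteinSeries.linear_right_summable z 1 (k := 2) le_rfl
    refine this.congr fun n => ?_
    rw [Int.cast_one, one_mul, one_div]
    norm_cast
  have h := (hsum.hasSum.mul_left (((2 * Real.pi * Complex.I : ℂ) ^ 2)⁻¹))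
  rw [hid] at h
  convert! h using 1
  · funext n
    have : v + n * (2 * Real.pi * Complex.I) = (2 * Real.pi * Complex.I) * (z + n) := by
      rw [hz]
      field_simp
    rw [this, mul_pow, one_div, mul_inv, one_div]
  · rw [koebe, neg_mul, neg_mul, neg_sq, inv_mul_cancel_left₀ (pow_ne_zero 2 hpi)]

/-- The point πi is on the imaginary axis, out of reach of the half-plane formula, but it occurs
when |z| = √r. There the sum reduces to that of the inverse odd squares, deduced from ζ(2), and both
sides equal -1/4. -/
theorem hasSum_one_div_sq_pi_I :
    HasSum (fun n : ℤ => 1 / (Real.pi * Complex.I + n * (2 * Real.pi * Complex.I)) ^ 2)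
      (koebe (Complex.exp (Real.pi * Complex.I))) := by
  have hpi := Real.pi_ne_zero
  have hev : HasSum (fun n : ℕ => (1 : ℝ) / ((2 * n : ℕ) : ℝ) ^ 2) (4⁻¹ * (Real.pi ^ 2 / 6)) := by
    convert! hasSum_zeta_two.mul_left (4⁻¹ : ℝ) using 2 with n
    push_cast
    rw [mul_pow, one_div, mul_inv]
    norm_num
  have hsodd : Summable fun n : ℕ => (1 : ℝ) / ((2 * n + 1 : ℕ) : ℝ) ^ 2 :=
    hasSum_zeta_two.summable.comp_injective (i := fun n : ℕ => 2 * n + 1)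
      fun a b h => by simpa using h
  have hodd : HasSum (fun n : ℕ => (1 : ℝ) / ((2 * n + 1 : ℕ) : ℝ) ^ 2) (Real.pi ^ 2 / 8) := by
    have h := (hev.even_add_odd (f := fun n : ℕ => (1 : ℝ) / (n : ℝ) ^ 2) hsodd.hasSum).unique
      hasSum_zeta_two
    have h' : ∑' n : ℕ, (1 : ℝ) / ((2 * n + 1 : ℕ) : ℝ) ^ 2 = Real.pi ^ 2 / 8 := by linarith
    exact h' ▸ hsodd.hasSum
  have hZ : HasSum (fun n : ℤ => (1 : ℝ) / (2 * n + 1 : ℝ) ^ 2) (Real.pi ^ 2 / 8 + Real.pi ^ 2 / 8) := by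
    apply HasSum.of_nat_of_neg_add_one
    · convert! hodd using 2 with n
      push_cast
      rfl
    · convert! hodd using 2 with n
      push_cast
      congr 1
      ring
  have h := (Complex.hasSum_ofReal.2 hZ).mul_left (((Real.pi * Complex.I : ℂ) ^ 2)⁻¹)
  have hpic : (Real.pi : ℂ) ≠ 0 := by exact_mod_cast hpi
  convert! h using 1
  · funext n
    have : (Real.pi * Complex.I + n * (2 * Real.pi * Complex.I) : ℂ) =
        (Real.pi * Complex.I) * (2 * n + 1) := by ring
    rw [this, mul_pow, one_div, mul_inv]
    push_cast
    rw [one_div]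
  · rw [Complex.exp_pi_mul_I, koebe, mul_pow, Complex.I_sq]
    push_cast
    field_simp
    norm_num

theorem hasSum_one_div_sq {v : ℂ} (hv : v.re ≠ 0 ∨ v = Real.pi * Complex.I) :
    HasSum (fun n : ℤ => 1 / (v - n * (2 * Real.pi * Complex.I)) ^ 2) (koebe (Complex.exp v)) := by
  have hneg : ∀ w : ℂ,
      HasSum (fun n : ℤ => 1 / (w + n * (2 * Real.pi * Complex.I)) ^ 2) (koebe (Complex.exp w)) →
      HasSum (fun n : ℤ => 1 / (w - n * (2 * Real.pi * Complex.I)) ^ 2) (koebe (Complex.exp w)) := by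
    intro w hw
    rw [← (Equiv.neg ℤ).hasSum_iff] at hw
    convert! hw using 2 with n
    simp [sub_eq_add_neg]
  rcases hv with hv | rfl
  · rcases lt_or_gt_of_ne hv with hv | hv
    · exact hneg v (hasSum_one_div_sq_of_re_neg hv)
    · have h := hasSum_one_div_sq_of_re_neg (v := -v) (by simpa using hv)
      rw [Complex.exp_neg, koebe_inv] at h
      convert! h using 2 with n
      rw [← neg_sq]
      congr 2
      ring
  · exact hneg _ hasSum_one_div_sq_pi_I

/-- The difference of two values of `℘`, summed over the rows of the lattice. -/
theorem hasSum_weierstrassP_sub (r : ℝ) (hr : r ∈ Set.Ioo (0 : ℝ) 1) {u u' : ℂ}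
    (hu : ∀ m : ℤ, (u - m * ((-2 * Real.log r : ℝ) : ℂ)).re ≠ 0 ∨
      u - m * ((-2 * Real.log r : ℝ) : ℂ) = Real.pi * Complex.I)
    (hu' : ∀ m : ℤ, (u' - m * ((-2 * Real.log r : ℝ) : ℂ)).re ≠ 0 ∨
      u' - m * ((-2 * Real.log r : ℝ) : ℂ) = Real.pi * Complex.I) :
    HasSum (fun m : ℤ => koebe (Complex.exp (u - m * ((-2 * Real.log r : ℝ) : ℂ))) -
        koebe (Complex.exp (u' - m * ((-2 * Real.log r : ℝ) : ℂ))))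
      ((annulusPeriods r hr).weierstrassP u - (annulusPeriods r hr).weierstrassP u') := by
  set L := annulusPeriods r hr
  -- In the difference the correction terms 1/l² cancel, and summability over the lattice allows
  -- summing first along each row.
  have h := (L.hasSum_weierstrassP u).sub (L.hasSum_weierstrassP u')
  rw [← L.latticeEquivProd.symm.toEquiv.hasSum_iff] at h
  refine h.prod_fiberwise fun m => ?_
  have h1 := (hasSum_one_div_sq (hu m)).sub (hasSum_one_div_sq (hu' m))
  convert! h1 using 2 with n
  have hl : ((L.latticeEquivProd.symm (m, n) : L.lattice) : ℂ) =
      m * ((-2 * Real.log r : ℝ) : ℂ) + n * (2 * Real.pi * Complex.I) :=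
    L.latticeEquiv_symm_apply (m, n)
  simp only [Function.comp_apply, LinearEquiv.coe_toEquiv, hl, sub_add_eq_sub_sub]
  ring

/-! ### Wirtinger derivatives of radial functions and the metric -/

section

theorem hasFDerivAt_comp_norm_sq {ψ : ℝ → ℂ} {ψ' z : ℂ} (h : HasDerivAt ψ ψ' (‖z‖ ^ 2)) :
    HasFDerivAt (fun w : ℂ => ψ (‖w‖ ^ 2))
      (((2 : ℕ) • innerSL ℝ z : ℂ →L[ℝ] ℝ).smulRight ψ') z :=
  h.hasFDerivAt.comp (f := fun w : ℂ => ‖w‖ ^ 2) z (hasStrictFDerivAt_norm_sq z).hasFDerivAt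

theorem wirtingerBar_comp_norm_sq {ψ : ℝ → ℂ} {ψ' z : ℂ} (h : HasDerivAt ψ ψ' (‖z‖ ^ 2)) :
    wirtingerBar (fun w => ψ (‖w‖ ^ 2)) z = ψ' * z := by
  rw [wirtingerBar, (hasFDerivAt_comp_norm_sq h).fderiv]
  simp [Complex.inner]
  linear_combination ψ' * Complex.re_add_im z

/-- The ∂/∂z̄ derivative of g(|w|²) is g'(|w|²)w; taking ψ = g' here gives ∂∂̄ g(|w|²) = (x g')' at
x = |w|². -/
theorem wirtinger_comp_norm_sq_mul {ψ : ℝ → ℂ} {ψ' z : ℂ} (h : HasDerivAt ψ ψ' (‖z‖ ^ 2)) :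
    wirtinger (fun w => ψ (‖w‖ ^ 2) * w) z = ψ' * ((‖z‖ ^ 2 : ℝ) : ℂ) + ψ (‖z‖ ^ 2) := by
  have h1 := (hasFDerivAt_comp_norm_sq h).mul (hasFDerivAt_id (𝕜 := ℝ) z)
  have h2 : HasFDerivAt (fun w => ψ (‖w‖ ^ 2) * w) _ z := h1
  have h3 : ((‖z‖ ^ 2 : ℝ) : ℂ) = z * (z.re - z.im * Complex.I) := by
    have := Complex.mul_conj' z
    have hc : conj z = z.re - z.im * Complex.I := by apply Complex.ext <;> simp
    rw [← hc, this]
    push_cast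
    rfl
  rw [wirtinger, h2.fderiv, h3]
  simp [Complex.inner]
  linear_combination (-ψ (‖z‖ ^ 2) / 2) * Complex.I_sq

theorem wirtinger_congr {f g : ℂ → ℂ} {z : ℂ} (h : f =ᶠ[𝓝 z] g) : wirtinger f z = wirtinger g z := by
  rw [wirtinger, wirtinger, h.fderiv_eq]

theorem wirtingerBar_congr {f g : ℂ → ℂ} {z : ℂ} (h : f =ᶠ[𝓝 z] g) :
    wirtingerBar f z = wirtingerBar g z := by
  rw [wirtingerBar, wirtingerBar, h.fderiv_eq]

variable {r : ℝ} [hr : Fact (r ∈ Set.Ioo (0 : ℝ) 1)]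

theorem norm_sq_mem_of_mem_annulus {z : ℂ} (hz : z ∈ annulus r) : r ^ 2 < ‖z‖ ^ 2 ∧ ‖z‖ ^ 2 < 1 := by
  have h0 := hr.out.1
  have h1 := hz.1
  have h2 := hz.2
  constructor <;> nlinarith [norm_nonneg z]

theorem IsSzegoKernel.diag_pos {S : ℂ → ℂ → ℂ}
    (hS : IsSzegoKernel (annulus r) (annulusArcLength r) S) {z : ℂ} (hz : z ∈ annulus r) :
    0 < (S z z).re := by
  have hz0 : 0 < ‖z‖ := hr.out.1.trans hz.1
  have hpos : ∀ n : ℤ, 0 < (‖z‖ ^ 2) ^ n / monomialSqNorm r n := fun n =>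
    div_pos (zpow_pos (by positivity) n) (monomialSqNorm_pos n)
  exact (hpos 0).trans_le (le_hasSum (hS.hasSum_diag hz) 0 fun n _ => (hpos n).le)

theorem IsSzegoKernel.log_diag {S : ℂ → ℂ → ℂ}
    (hS : IsSzegoKernel (annulus r) (annulusArcLength r) S) {z : ℂ} (hz : z ∈ annulus r) :
    Real.log (S z z).re = (logThetaQuotient r ((‖z‖ ^ 2 : ℝ) : ℂ)).re -
      Real.log (2 * Real.pi * ‖thetaQuotient r 1‖) := by
  have h0 := hr.out.1
  obtain ⟨h1, h2⟩ := norm_sq_mem_of_mem_annulus hz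
  have hpos := hS.diag_pos hz
  have hn : ‖((‖z‖ ^ 2 : ℝ) : ℂ)‖ = ‖z‖ ^ 2 := by
    rw [Complex.norm_real, Real.norm_of_nonneg (by positivity)]
  have hT := hasSum_thetaQuotient (x := ((‖z‖ ^ 2 : ℝ) : ℂ)) (hn.symm ▸ h1) (hn.symm ▸ h2)
  rw [← exp_logThetaQuotient h1 h2] at hT
  have hD := (Complex.hasSum_ofReal.2 (hS.hasSum_diag hz)).mul_left
    (2 * Real.pi * thetaQuotient r 1)
  have hpi : (Real.pi : ℂ) ≠ 0 := by exact_mod_cast Real.pi_ne_zero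
  have heq : Complex.exp (logThetaQuotient r ((‖z‖ ^ 2 : ℝ) : ℂ)) =
      2 * Real.pi * thetaQuotient r 1 * (S z z).re := by
    refine hT.unique ?_
    convert! hD using 2 with n
    rw [monomialSqNorm]
    push_cast
    field_simp
  have hg : 0 < ‖thetaQuotient r 1‖ := norm_pos_iff.2 thetaQuotient_one_ne_zero
  -- Since |exp w| = exp(Re w), taking norms removes both the branch of the logarithm and the phase
  -- of the constant.
  have hnorm := congrArg norm heq
  rw [Complex.norm_exp, norm_mul, norm_mul, norm_mul, Complex.norm_real, Complex.norm_real,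
    Real.norm_of_nonneg hpos.le, Real.norm_of_nonneg Real.pi_pos.le, Complex.norm_two] at hnorm
  have hl := congrArg Real.log hnorm
  have hpi' := Real.pi_pos
  rw [Real.log_exp, Real.log_mul (by positivity) hpos.ne'] at hl
  linarith

theorem IsSzegoKernel.contDiffOn_log_diag {S : ℂ → ℂ → ℂ}
    (hS : IsSzegoKernel (annulus r) (annulusArcLength r) S) :
    ContDiffOn ℝ 2 (fun z => Real.log (S z z).re) (annulus r) := by
  refine ContDiffOn.congr (f := fun z => (logThetaQuotient r ((‖z‖ ^ 2 : ℝ) : ℂ)).re -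
      Real.log (2 * Real.pi * ‖thetaQuotient r 1‖)) (fun z hz => ?_) fun z hz => hS.log_diag hz
  obtain ⟨h1, h2⟩ := norm_sq_mem_of_mem_annulus hz
  have hA : ContDiffAt ℝ 2 (logThetaQuotient r) ((‖z‖ ^ 2 : ℝ) : ℂ) :=
    (analyticAt_logThetaQuotient_and_hasSum h1 h2).1.contDiffAt.restrict_scalars ℝ
  have hN : ContDiffAt ℝ 2 (fun z : ℂ => ((‖z‖ ^ 2 : ℝ) : ℂ)) z :=
    (Complex.ofRealCLM.contDiff.comp (contDiff_norm_sq ℝ)).contDiffAt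
  have hR : ContDiffAt ℝ 2 (fun z : ℂ => (logThetaQuotient r ((‖z‖ ^ 2 : ℝ) : ℂ)).re) z :=
    Complex.reCLM.contDiff.contDiffAt.comp z
      (hA.comp (f := fun z : ℂ => ((‖z‖ ^ 2 : ℝ) : ℂ)) z hN)
  exact (hR.sub contDiffAt_const).contDiffWithinAt

theorem IsSzegoKernel.wirtinger_log_diag {S : ℂ → ℂ → ℂ}
    (hS : IsSzegoKernel (annulus r) (annulusArcLength r) S) {z : ℂ} (hz : z ∈ annulus r) {t : ℝ}
    (ht : eulerSq (logThetaQuotient r) ((‖z‖ ^ 2 : ℝ) : ℂ) = t) :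
    wirtinger (wirtingerBar fun w => ((Real.log (S w w).re : ℝ) : ℂ)) z =
      ((t / ‖z‖ ^ 2 : ℝ) : ℂ) := by
  have hz0 : 0 < ‖z‖ := hr.out.1.trans hz.1
  have hopen := isOpen_annulus r
  have hA : ∀ w ∈ annulus r, AnalyticAt ℂ (logThetaQuotient r) ((‖w‖ ^ 2 : ℝ) : ℂ) := fun w hw =>
    (analyticAt_logThetaQuotient_and_hasSum (norm_sq_mem_of_mem_annulus hw).1
      (norm_sq_mem_of_mem_annulus hw).2).1
  set C := Real.log (2 * Real.pi * ‖thetaQuotient r 1‖)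
  have h1 : ∀ w ∈ annulus r, wirtingerBar (fun w => ((Real.log (S w w).re : ℝ) : ℂ)) w =
      (((deriv (logThetaQuotient r) ((‖w‖ ^ 2 : ℝ) : ℂ)).re : ℝ) : ℂ) * w := by
    intro w hw
    have hc : (fun w => ((Real.log (S w w).re : ℝ) : ℂ)) =ᶠ[𝓝 w]
        fun w => (fun x : ℝ => (((logThetaQuotient r (x : ℂ)).re - C : ℝ) : ℂ)) (‖w‖ ^ 2) := by
      filter_upwards [hopen.mem_nhds hw] with v hv
      rw [hS.log_diag hv]
    rw [wirtingerBar_congr hc]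
    have hd := ((hA w hw).differentiableAt.hasDerivAt.real_of_complex.sub_const C).ofReal_comp
    exact wirtingerBar_comp_norm_sq hd
  have h2 : wirtingerBar (fun w => ((Real.log (S w w).re : ℝ) : ℂ)) =ᶠ[𝓝 z]
      fun w => (fun x : ℝ => (((deriv (logThetaQuotient r) (x : ℂ)).re : ℝ) : ℂ)) (‖w‖ ^ 2) * w := by
    filter_upwards [hopen.mem_nhds hz] with w hw using h1 w hw
  -- Differentiation along the real axis commutes with taking real parts, so the complex derivatives
  -- of `logThetaQuotient` suffice.
  have hd := (hA z hz).deriv.differentiableAt.hasDerivAt.real_of_complex.ofReal_comp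
  rw [wirtinger_congr h2, wirtinger_comp_norm_sq_mul hd]
  rw [eulerSq_eq (hA z hz)] at ht
  have hre := congrArg Complex.re ht
  rw [Complex.re_ofReal_mul, Complex.add_re, Complex.re_ofReal_mul, Complex.ofReal_re] at hre
  rw [← hre]
  have hx : ((‖z‖ : ℝ) : ℂ) ≠ 0 := by exact_mod_cast hz0.ne'
  push_cast
  field_simp
  ring

/-- `(x d/dx)² log (θ(-r x) / θ(x))` as a difference of values of `℘`. -/
theorem eulerSq_logThetaQuotient_eq_weierstrassP {z : ℂ} (hz : z ∈ annulus r) :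
    eulerSq (logThetaQuotient r) ((‖z‖ ^ 2 : ℝ) : ℂ) =
      (annulusPeriods r hr.out).weierstrassP ((2 * Real.log ‖z‖ : ℝ) : ℂ) -
        (annulusPeriods r hr.out).weierstrassP
          (((2 * Real.log ‖z‖ : ℝ) : ℂ) + ((-Real.log r : ℝ) : ℂ) + (Real.pi : ℂ) * Complex.I) := by
  have h0 := hr.out.1
  have hz0 : 0 < ‖z‖ := h0.trans hz.1
  have hl1 : Real.log r < Real.log ‖z‖ := Real.log_lt_log h0 hz.1
  have hl2 : Real.log ‖z‖ < 0 := Real.log_neg hz0 hz.2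
  obtain ⟨h1, h2⟩ := norm_sq_mem_of_mem_annulus hz
  refine (analyticAt_logThetaQuotient_and_hasSum h1 h2).2.unique ?_
  have hP := hasSum_weierstrassP_sub r hr.out (u := ((2 * Real.log ‖z‖ : ℝ) : ℂ))
    (u' := ((2 * Real.log ‖z‖ : ℝ) : ℂ) + ((-Real.log r : ℝ) : ℂ) + (Real.pi : ℂ) * Complex.I)
    (fun m => Or.inl ?_) fun m => ?_
  · convert! hP using 2 with n
    have hexp : ∀ m : ℤ, Complex.exp (((2 * Real.log ‖z‖ : ℝ) : ℂ) -
        m * ((-2 * Real.log r : ℝ) : ℂ)) = ((r ^ 2 : ℝ) : ℂ) ^ m * ((‖z‖ ^ 2 : ℝ) : ℂ) := by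
      intro m
      have : Real.exp (2 * Real.log ‖z‖ - m * (-2 * Real.log r)) = (r ^ 2) ^ m * ‖z‖ ^ 2 := by
        have e1 : 2 * Real.log ‖z‖ - m * (-2 * Real.log r) =
            Real.log (r ^ 2) * m + Real.log (‖z‖ ^ 2) := by
          rw [Real.log_pow, Real.log_pow]
          push_cast
          ring
        rw [e1, Real.exp_add, Real.exp_log (by positivity), ← Real.rpow_def_of_pos (by positivity),
          Real.rpow_intCast]
      exact_mod_cast congrArg (fun s : ℝ => (s : ℂ)) this
    have hexp' : Complex.exp (((2 * Real.log ‖z‖ : ℝ) : ℂ) + ((-Real.log r : ℝ) : ℂ) +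
        (Real.pi : ℂ) * Complex.I - n * ((-2 * Real.log r : ℝ) : ℂ)) =
        -(((r ^ 2 : ℝ) : ℂ) ^ n * ((‖z‖ ^ 2 : ℝ) : ℂ)) / r := by
      have e : ((2 * Real.log ‖z‖ : ℝ) : ℂ) + ((-Real.log r : ℝ) : ℂ) + (Real.pi : ℂ) * Complex.I -
          n * ((-2 * Real.log r : ℝ) : ℂ) = (((2 * Real.log ‖z‖ : ℝ) : ℂ) -
          n * ((-2 * Real.log r : ℝ) : ℂ)) + ((-Real.log r : ℝ) : ℂ) + (Real.pi : ℂ) * Complex.I := by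
        ring
      rw [e, Complex.exp_add, Complex.exp_add, hexp, Complex.exp_pi_mul_I, ← Complex.ofReal_exp,
        Real.exp_neg, Real.exp_log h0]
      push_cast
      ring
    rw [lambertTerm, hexp, hexp']
  -- Log|z| lies strictly between log r and 0, so no row of the first ℘ meets the imaginary axis.
  · have hre : (((2 * Real.log ‖z‖ : ℝ) : ℂ) - m * ((-2 * Real.log r : ℝ) : ℂ)).re =
        2 * (Real.log ‖z‖ + m * Real.log r) := by
      rw [← Complex.ofReal_intCast, ← Complex.ofReal_mul, ← Complex.ofReal_sub, Complex.ofReal_re]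
      ring
    rw [hre]
    intro h
    have h3 : Real.log ‖z‖ + m * Real.log r = 0 := by linarith
    rcases le_or_gt m (-1) with hm | hm
    · have : (m : ℝ) ≤ -1 := by exact_mod_cast hm
      nlinarith
    · have : (0 : ℝ) ≤ m := by exact_mod_cast (by omega : 0 ≤ m)
      nlinarith
  · have he : ((2 * Real.log ‖z‖ : ℝ) : ℂ) + ((-Real.log r : ℝ) : ℂ) + (Real.pi : ℂ) * Complex.I -
        m * ((-2 * Real.log r : ℝ) : ℂ) =
        ((2 * Real.log ‖z‖ - Real.log r + m * (2 * Real.log r) : ℝ) : ℂ) +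
          (Real.pi : ℂ) * Complex.I := by
      push_cast
      ring
    rw [he]
    -- The real part vanishes only for m = 0 and |z| = √r, where the point is exactly πi.
    by_cases h : 2 * Real.log ‖z‖ - Real.log r + m * (2 * Real.log r) = 0
    · right
      rw [h, Complex.ofReal_zero, zero_add]
    · left
      simpa using h

end

end Szego

end

theorem proposition1p5 (r : ℝ) (hr : r ∈ Set.Ioo (0 : ℝ) 1) :
    (∃ S : ℂ → ℂ → ℂ, Szego.IsSzegoKernel (Szego.annulus r) (Szego.annulusArcLength r) S) ∧
    ∀ S : ℂ → ℂ → ℂ, Szego.IsSzegoKernel (Szego.annulus r) (Szego.annulusArcLength r) S →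
      (∀ z ∈ Szego.annulus r, 0 < (S z z).re) ∧
      ContDiffOn ℝ 2 (fun z => Real.log (S z z).re) (Szego.annulus r) ∧
      ∀ z ∈ Szego.annulus r,
        0 < Szego.szegoMetric S z ∧
        (((Szego.szegoMetric S z) ^ 2 : ℝ) : ℂ) =
          ((Szego.annulusPeriods r hr).weierstrassP ((2 * Real.log ‖z‖ : ℝ) : ℂ) -
            (Szego.annulusPeriods r hr).weierstrassP
              (((2 * Real.log ‖z‖ : ℝ) : ℂ) + ((-Real.log r : ℝ) : ℂ) +
                (Real.pi : ℂ) * Complex.I)) / ((‖z‖ ^ 2 : ℝ) : ℂ) := by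
  have : Fact (r ∈ Set.Ioo (0 : ℝ) 1) := ⟨hr⟩
  refine ⟨⟨_, Szego.isSzegoKernel_annulusKernel⟩, fun S hS => ⟨fun z hz => hS.diag_pos hz,
    hS.contDiffOn_log_diag, fun z hz => ?_⟩⟩
  obtain ⟨h1, h2⟩ := Szego.norm_sq_mem_of_mem_annulus hz
  obtain ⟨t, ht0, ht⟩ := Szego.eulerSq_logThetaQuotient_pos h1 h2
  have hz0 : 0 < ‖z‖ := hr.1.trans hz.1
  -- Besides s(z) > 0, this ensures that squaring undoes `Real.sqrt`, which is 0 on negative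
  -- numbers.
  have hpos : 0 < t / ‖z‖ ^ 2 := by positivity
  have hmetric : Szego.szegoMetric S z = √(t / ‖z‖ ^ 2) := by
    rw [Szego.szegoMetric, hS.wirtinger_log_diag hz ht, Complex.ofReal_re]
  refine ⟨hmetric ▸ Real.sqrt_pos.2 hpos, ?_⟩
  rw [hmetric, Real.sq_sqrt hpos.le, ← Szego.eulerSq_logThetaQuotient_eq_weierstrassP hz, ht]
  push_cast
  rfl
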